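/- \textsc{Weighted Subset Odd Cycle Transversal} is solvable in polynomial time on $P_4$-free graphs. That is, there are a deterministic algorithm and a polynomial $q$ with the following property. Let $G=(V,E)$ be a finite simple undirected graph that is $P_4$-free (it has no induced subgraph isomorphic to the path on four vertices), let $T\subseteq V$, let $w\colon V\to\mathbb{Q}_{\ge 0}$ be a non-negative vertex weighting, and let $k\ge 1$ be an integer. Given $(G,T,w,k)$, with $G$ as an adjacency matrix, $T$ as an indicator vector, and $k$ and the numerators and denominators of the weights written in binary, the algorithm halts within time $q(\ell)$, where $\ell$ is the length of this input in bits and time is measured on a random access machine with logarithmic cost, and it decides correctly whether there is a set $S\subseteq V$ with $\sum_{v\in S}w(v)\le k$ that contains at least one vertex of every cycle of $G$ that has an odd number of vertices and contains a vertex of $T$. -/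

import Mathlib

/-! ### A random access machine with logarithmic cost

The machine works on natural numbers. It has registers `reg 0, reg 1, …` (a program names only
finitely many of them) and an indirectly addressed memory `mem`. Every operation is charged the
number of binary digits of the numbers and addresses it handles, so that polynomial time on this
machine is polynomial time in the usual (Turing machine) sense. -/

namespace RAM

/-- The contents of the registers and of the memory. -/
structure State where
  reg : ℕ → ℕ
  mem : ℕ → ℕ

/-- The binary operations of the machine. -/
inductive Op
  | add | sub | mul | div | lt | eq

/-- Subtraction is truncated, division is rounded down (and `a / 0 = 0`), tests yield `0` or `1`. -/
def Op.eval : Op → ℕ → ℕ → ℕ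
  | .add, a, b => a + b
  | .sub, a, b => a - b
  | .mul, a, b => a * b
  | .div, a, b => a / b
  | .lt, a, b => if a < b then 1 else 0
  | .eq, a, b => if a = b then 1 else 0

/-- Arithmetic expressions: constants, registers, memory access at a computed address, operations. -/
inductive Expr
  | const (c : ℕ)
  | reg (x : ℕ)
  | load (a : Expr)
  | bin (o : Op) (a b : Expr)

/-- The value of an expression in a state. -/
def Expr.eval (s : State) : Expr → ℕ
  | .const c => c
  | .reg x => s.reg x
  | .load a => s.mem (a.eval s)
  | .bin o a b => o.eval (a.eval s) (b.eval s)

/-- The logarithmic cost of evaluating an expression: every subexpression is charged one more than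
the number of binary digits of its value. -/
def Expr.cost (s : State) : Expr → ℕ
  | .const c => Nat.size c + 1
  | .reg x => Nat.size (s.reg x) + 1
  | .load a => a.cost s + Nat.size (s.mem (a.eval s)) + 1
  | .bin o a b => a.cost s + b.cost s + Nat.size (o.eval (a.eval s) (b.eval s)) + 1

/-- Programs. `assign x e` is `reg x := e`, `store a e` is `mem a := e`, and `loop e p` is
`while e ≠ 0 do p`. -/
inductive Prog
  | skip
  | assign (x : ℕ) (e : Expr)
  | store (a e : Expr)
  | seq (p q : Prog)
  | cond (e : Expr) (p q : Prog)
  | loop (e : Expr) (p : Prog)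

/-- `Exec p s s' t`: started in state `s`, the program `p` halts in state `s'` after time `t`. -/
inductive Exec : Prog → State → State → ℕ → Prop
  | skip (s : State) : Exec .skip s s 1
  | assign (x : ℕ) (e : Expr) (s : State) :
      Exec (.assign x e) s ⟨Function.update s.reg x (e.eval s), s.mem⟩ (e.cost s + 1)
  | store (a e : Expr) (s : State) :
      Exec (.store a e) s ⟨s.reg, Function.update s.mem (a.eval s) (e.eval s)⟩
        (a.cost s + e.cost s + 1)
  | seq {p q : Prog} {s s' s'' : State} {t t' : ℕ} :
      Exec p s s' t → Exec q s' s'' t' → Exec (.seq p q) s s'' (t + t')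
  | cond_true {e : Expr} {p q : Prog} {s s' : State} {t : ℕ} :
      e.eval s ≠ 0 → Exec p s s' t → Exec (.cond e p q) s s' (e.cost s + 1 + t)
  | cond_false {e : Expr} {p q : Prog} {s s' : State} {t : ℕ} :
      e.eval s = 0 → Exec q s s' t → Exec (.cond e p q) s s' (e.cost s + 1 + t)
  | loop_done {e : Expr} {p : Prog} {s : State} :
      e.eval s = 0 → Exec (.loop e p) s s (e.cost s + 1)
  | loop_step {e : Expr} {p : Prog} {s s' s'' : State} {t t' : ℕ} :
      e.eval s ≠ 0 → Exec p s s' t → Exec (.loop e p) s' s'' t' →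
      Exec (.loop e p) s s'' (e.cost s + 1 + t + t')

/-- The machine is deterministic: final state and running time are determined by the start. -/
theorem Exec.deterministic {p : Prog} {s s₁ s₂ : State} {t₁ t₂ : ℕ}
    (h₁ : Exec p s s₁ t₁) (h₂ : Exec p s s₂ t₂) : s₁ = s₂ ∧ t₁ = t₂ := by
  induction h₁ generalizing s₂ t₂ with
  | skip s => cases h₂; exact ⟨rfl, rfl⟩
  | assign x e s => cases h₂; exact ⟨rfl, rfl⟩
  | store a e s => cases h₂; exact ⟨rfl, rfl⟩
  | seq _ _ ih ih' =>
    cases h₂ with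
    | seq g g' =>
      obtain ⟨rfl, rfl⟩ := ih g
      obtain ⟨rfl, rfl⟩ := ih' g'
      exact ⟨rfl, rfl⟩
  | cond_true he _ ih =>
    cases h₂ with
    | cond_true _ g =>
      obtain ⟨rfl, rfl⟩ := ih g
      exact ⟨rfl, rfl⟩
    | cond_false he' _ => exact absurd he' he
  | cond_false he _ ih =>
    cases h₂ with
    | cond_true he' _ => exact absurd he he'
    | cond_false _ g =>
      obtain ⟨rfl, rfl⟩ := ih g
      exact ⟨rfl, rfl⟩
  | loop_done he =>
    cases h₂ with
    | loop_done _ => exact ⟨rfl, rfl⟩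
    | loop_step he' _ _ => exact absurd he he'
  | loop_step he _ _ ih ih' =>
    cases h₂ with
    | loop_done he' => exact absurd he' he
    | loop_step _ g g' =>
      obtain ⟨rfl, rfl⟩ := ih g
      obtain ⟨rfl, rfl⟩ := ih' g'
      exact ⟨rfl, rfl⟩

/-- At the start the input list occupies the memory cells `0, 1, …`, its length is in register `0`,
and everything else is `0`. -/
def init (l : List ℕ) : State where
  reg := fun x => if x = 0 then l.length else 0
  mem := fun i => l.getD i 0

/-- The length of an input in binary (with one separator for each number). -/
def inputSize (l : List ℕ) : ℕ := (l.map fun x => Nat.size x + 1).sum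

/-- The decision problem with instances `α`, encoding `enc` and yes-instances `Yes` is solvable in
polynomial time on the instances in the class `C`: one program halts on every instance of `C` within
time polynomial in the length of the input, with answer `1` or `0` in register `0`. -/
def PolyTimeSolvableOn {α : Type*} (enc : α → List ℕ) (Yes : α → Prop) (C : α → Prop) : Prop :=
  ∃ (p : Prog) (q : Polynomial ℕ), ∀ a : α, C a →
    ∃ (s : State) (t : ℕ), Exec p (init (enc a)) s t ∧ t ≤ q.eval (inputSize (enc a)) ∧
      (Yes a → s.reg 0 = 1) ∧ (¬ Yes a → s.reg 0 = 0)

end RAM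

/-! ### Weighted Subset Odd Cycle Transversal -/

/-- `S` is an odd `T`-cycle transversal of `G`: it contains a vertex of every cycle of `G` that has
an odd number of vertices and contains a vertex of `T`. -/
def IsOddCycleTransversal {V : Type*} (G : SimpleGraph V) (T S : Set V) : Prop :=
  ∀ (v : V) (c : G.Walk v v), c.IsCycle → Odd c.length →
    (∃ t ∈ T, t ∈ c.support) → ∃ s ∈ S, s ∈ c.support

/-- `G` is `H`-free: it has no induced subgraph isomorphic to `H`. -/
def IsFree {U V : Type*} (H : SimpleGraph U) (G : SimpleGraph V) : Prop :=
  ¬ H.IsIndContained G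

/-- The instances: a finite graph `G`, a set `T` of vertices, a non-negative vertex weighting `w`
(rational, so that it can be written down) and an integer `k ≥ 1`. -/
structure WSOCT where
  n : ℕ
  G : SimpleGraph (Fin n)
  T : Finset (Fin n)
  w : Fin n → ℚ≥0
  k : ℕ
  one_le_k : 1 ≤ k

namespace WSOCT

/-- Does `G` have an odd `T`-cycle transversal of weight at most `k`? -/
def IsYes (I : WSOCT) : Prop :=
  ∃ S : Finset (Fin I.n), IsOddCycleTransversal I.G (I.T : Set (Fin I.n)) (S : Set (Fin I.n)) ∧
    ∑ v ∈ S, I.w v ≤ (I.k : ℚ≥0)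

open Classical in
/-- The encoding of an instance: `n`, `k`, the indicator vector of `T`, the numerators and the
denominators of the weights, and the adjacency matrix of `G`, row by row. -/
noncomputable def encode (I : WSOCT) : List ℕ :=
  [I.n, I.k] ++ List.ofFn (fun v : Fin I.n => if v ∈ I.T then 1 else 0) ++
    List.ofFn (fun v : Fin I.n => (I.w v).num) ++ List.ofFn (fun v : Fin I.n => (I.w v).den) ++
    List.ofFn (fun e : Fin (I.n * I.n) => if I.G.Adj e.divNat e.modNat then 1 else 0)

end WSOCT

/-! Passing to complements, the task is to maximise the weight of a vertex set `F` for which `G[F]`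
has no odd cycle through `T`. The vertex set of a cycle in a P₄-free graph splits into two parts
with all or no edges between them (`NoInducedP4.splits`), and connectedness leaves only the join. It
follows that an odd cycle through `t ∈ T` comes with a triangle or a 5-cycle through `t` on the same
vertices (`NoInducedP4.isOddCycleTransversal`), so admissibility of `F` becomes the local condition
`NoShortOddCycle`.

This condition can be optimised along a decomposition into disjoint unions and joins. For disjoint
unions the optimum is additive. In a join, two nonempty pieces are compatible exactly when both are
independent, or both avoid `T`, or one has its `T`-vertices isolated and the other is a single
vertex outside `T` (`best_noShortOddCycle_join`). The five maxima involved satisfy a closed system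
of recurrences.

No cotree is built. The algorithm keeps a partition of the vertices into classes, uniformly joined
or unjoined to each other, with the five maxima of each class stored at a representative. The
representatives induce a P₄-free graph, so if at least two are left, some two are twins
(`NoInducedP4.exists_twins`); merging twins keeps the partition uniform. A pass over all pairs
merges at least once (`wp_round`), so `n` passes leave at most one class.

The time bound rests on one additive quantity, the weight of a run (`Within`): weight `u` means that
numbers grow by at most `u` digits and that the time is at most `u * (B + u + 1)` if they start with
at most `B` digits. Polynomial weight therefore gives polynomial time, with no separate control of
the size of intermediate values. -/

/-! ### Weights of runs and a program logic for the machine -/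

namespace RAM

/-- All registers and memory cells hold numbers with at most `B` binary digits. -/
def State.Bdd (s : State) (B : ℕ) : Prop :=
  (∀ x, Nat.size (s.reg x) ≤ B) ∧ ∀ i, Nat.size (s.mem i) ≤ B

/-- The state after writing `v` to register `x`. -/
def State.set (s : State) (x v : ℕ) : State := ⟨Function.update s.reg x v, s.mem⟩

/-- The state after writing `v` to the memory cell `a`. -/
def State.put (s : State) (a v : ℕ) : State := ⟨s.reg, Function.update s.mem a v⟩

@[simp] theorem State.set_reg (s : State) (x v y : ℕ) :
    (s.set x v).reg y = if y = x then v else s.reg y := by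
  simp [State.set, Function.update_apply]

@[simp] theorem State.set_mem (s : State) (x v : ℕ) : (s.set x v).mem = s.mem := rfl

@[simp] theorem State.put_reg (s : State) (a v : ℕ) : (s.put a v).reg = s.reg := rfl

theorem State.put_mem (s : State) (a v b : ℕ) :
    (s.put a v).mem b = if b = a then v else s.mem b := by
  simp [State.put, Function.update_apply]

theorem State.Bdd.mono {s : State} {B C : ℕ} (h : s.Bdd B) (hBC : B ≤ C) : s.Bdd C :=
  ⟨fun x => (h.1 x).trans hBC, fun i => (h.2 i).trans hBC⟩

theorem State.Bdd.set {s : State} {B v : ℕ} (h : s.Bdd B) (x : ℕ) (hv : Nat.size v ≤ B) :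
    (s.set x v).Bdd B := by
  refine ⟨fun y => ?_, h.2⟩
  rw [State.set_reg]
  split_ifs
  exacts [hv, h.1 y]

theorem State.Bdd.put {s : State} {B v : ℕ} (h : s.Bdd B) (a : ℕ) (hv : Nat.size v ≤ B) :
    (s.put a v).Bdd B := by
  refine ⟨h.1, fun i => ?_⟩
  rw [State.put_mem]
  split_ifs
  exacts [hv, h.2 i]

/-- The extra weight of an operation: the number of digits of the right factor of a product. -/
def Op.extra : Op → ℕ → ℕ
  | .mul, b => Nat.size b
  | _, _ => 0

/-- An upper bound both for the number of nodes of an expression and for the number of digits by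
which its value exceeds the contents of the machine. -/
def Expr.weight (s : State) : Expr → ℕ
  | .const c => c + 1
  | .reg _ => 1
  | .load a => a.weight s + 1
  | .bin o a b => a.weight s + b.weight s + o.extra (b.eval s) + 1

theorem size_le_self (c : ℕ) : Nat.size c ≤ c :=
  Nat.size_le.2 Nat.lt_two_pow_self

/-- A product is charged asymmetrically: it exceeds the left factor by at most the digits of the
right one. Repeated multiplication of an accumulator by short numbers thus costs only the sum of
their lengths. -/
theorem Op.size_eval_le (o : Op) {a b A C : ℕ} (ha : Nat.size a ≤ A) (hb : Nat.size b ≤ C) :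
    Nat.size (o.eval a b) ≤ max A C + o.extra b + 1 := by
  have h1 : Nat.size 1 = 1 := by decide
  cases o with
  | add =>
    rw [Nat.size_le] at *
    have h2 : 2 ^ A ≤ 2 ^ max A C := Nat.pow_le_pow_right (by norm_num) (le_max_left _ _)
    have h3 : 2 ^ C ≤ 2 ^ max A C := Nat.pow_le_pow_right (by norm_num) (le_max_right _ _)
    simp only [Op.eval, Op.extra, add_zero, pow_succ]
    omega
  | sub =>
    have : Nat.size (a - b) ≤ Nat.size a := Nat.size_le_size (Nat.sub_le _ _)
    simp only [Op.eval, Op.extra]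
    have := le_max_left A C
    omega
  | mul =>
    have : Nat.size (a * b) ≤ A + Nat.size b := by
      rw [Nat.size_le, pow_add]
      exact Nat.mul_lt_mul'' (Nat.size_le.1 ha) (Nat.lt_size_self b)
    simp only [Op.eval, Op.extra]
    have := le_max_left A C
    omega
  | div =>
    have : Nat.size (a / b) ≤ Nat.size a := Nat.size_le_size (Nat.div_le_self _ _)
    simp only [Op.eval, Op.extra]
    have := le_max_left A C
    omega
  | lt =>
    simp only [Op.eval, Op.extra]
    split_ifs <;> simp [h1]
  | eq =>
    simp only [Op.eval, Op.extra]
    split_ifs <;> simp [h1]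

theorem Expr.size_eval_le {s : State} {B : ℕ} (h : s.Bdd B) (e : Expr) :
    Nat.size (e.eval s) ≤ B + e.weight s := by
  induction e with
  | const c =>
    have := size_le_self c
    simp only [Expr.eval, Expr.weight]
    omega
  | reg x =>
    have := h.1 x
    simp only [Expr.eval, Expr.weight]
    omega
  | load a _ =>
    have := h.2 (a.eval s)
    simp only [Expr.eval, Expr.weight]
    omega
  | bin o a b iha ihb =>
    have := o.size_eval_le iha ihb
    simp only [Expr.eval, Expr.weight]
    omega

theorem Expr.cost_le {s : State} {B : ℕ} (h : s.Bdd B) (e : Expr) :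
    e.cost s ≤ e.weight s * (B + e.weight s + 1) := by
  induction e with
  | const c =>
    have := size_le_self c
    simp only [Expr.cost, Expr.weight]
    nlinarith
  | reg x =>
    have := h.1 x
    simp only [Expr.cost, Expr.weight]
    omega
  | load a ih =>
    have := h.2 (a.eval s)
    simp only [Expr.cost, Expr.weight]
    nlinarith
  | bin o a b iha ihb =>
    have hv := Expr.size_eval_le h (.bin o a b)
    simp only [Expr.cost, Expr.weight, Expr.eval] at *
    generalize o.extra (b.eval s) = x at *
    generalize a.weight s = p at *
    generalize b.weight s = q at *
    have h1 : p * (B + p + 1) ≤ p * (B + (p + q + x + 1) + 1) := Nat.mul_le_mul_left _ (by omega)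
    have h2 : q * (B + q + 1) ≤ q * (B + (p + q + x + 1) + 1) := Nat.mul_le_mul_left _ (by omega)
    have h3 : 0 ≤ x * (B + (p + q + x + 1) + 1) := Nat.zero_le _
    have h4 : (p + q + x + 1) * (B + (p + q + x + 1) + 1) = p * (B + (p + q + x + 1) + 1) +
      q * (B + (p + q + x + 1) + 1) + x * (B + (p + q + x + 1) + 1) +
      (B + (p + q + x + 1) + 1) := by ring
    omega

/-- The program `p` leads from `s` to `s'` with weight at most `u`: the weight bounds the growth of
the numbers and, together with their size, the running time. -/
def Within (p : Prog) (u : ℕ) (s s' : State) : Prop :=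
  ∀ B, s.Bdd B → s'.Bdd (B + u) ∧ ∃ t ≤ u * (B + u + 1), Exec p s s' t

theorem Within.mono {p : Prog} {u v : ℕ} {s s' : State} (h : Within p u s s') (huv : u ≤ v) :
    Within p v s s' := by
  intro B hB
  obtain ⟨h1, t, ht, he⟩ := h B hB
  exact ⟨h1.mono (by omega), t, ht.trans (Nat.mul_le_mul huv (by omega)), he⟩

theorem Within.skip (s : State) : Within .skip 1 s s :=
  fun B hB => ⟨hB.mono (by omega), 1, by omega, .skip s⟩

theorem Within.assign (x : ℕ) (e : Expr) (s : State) :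
    Within (.assign x e) (e.weight s + 1) s (s.set x (e.eval s)) := by
  intro B hB
  have h1 := Expr.size_eval_le hB e
  have h2 := Expr.cost_le hB e
  refine ⟨(hB.mono (by omega)).set x (by omega), _, ?_, .assign x e s⟩
  nlinarith

theorem Within.store (a e : Expr) (s : State) :
    Within (.store a e) (a.weight s + e.weight s + 1) s (s.put (a.eval s) (e.eval s)) := by
  intro B hB
  have h1 := Expr.size_eval_le hB e
  have h2 := Expr.cost_le hB e
  have h3 := Expr.cost_le hB a
  refine ⟨(hB.mono (by omega)).put _ (by omega), _, ?_, .store a e s⟩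
  nlinarith

/-- The second program starts with at most `B + u` digits, so the total time is at most `u * (B + u
+ 1) + v * (B + u + v + 1)`, which is below the bound for weight `u + v`. -/
theorem Within.seq {p q : Prog} {u v : ℕ} {s s' s'' : State} (h : Within p u s s')
    (h' : Within q v s' s'') : Within (.seq p q) (u + v) s s'' := by
  intro B hB
  obtain ⟨h1, t, ht, he⟩ := h B hB
  obtain ⟨h2, t', ht', he'⟩ := h' _ h1
  refine ⟨by rwa [← add_assoc], _, ?_, .seq he he'⟩
  nlinarith [Nat.zero_le (u * v)]

theorem Within.cond_true {e : Expr} {p q : Prog} {u : ℕ} {s s' : State} (hc : e.eval s ≠ 0)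
    (h : Within p u s s') : Within (.cond e p q) (e.weight s + 1 + u) s s' := by
  intro B hB
  obtain ⟨h1, t, ht, he⟩ := h B hB
  have h2 := Expr.cost_le hB e
  refine ⟨h1.mono (by omega), _, ?_, .cond_true hc he⟩
  nlinarith [Nat.zero_le (u * e.weight s)]

theorem Within.cond_false {e : Expr} {p q : Prog} {u : ℕ} {s s' : State} (hc : e.eval s = 0)
    (h : Within q u s s') : Within (.cond e p q) (e.weight s + 1 + u) s s' := by
  intro B hB
  obtain ⟨h1, t, ht, he⟩ := h B hB
  have h2 := Expr.cost_le hB e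
  refine ⟨h1.mono (by omega), _, ?_, .cond_false hc he⟩
  nlinarith [Nat.zero_le (u * e.weight s)]

theorem Within.loop_done {e : Expr} {p : Prog} {s : State} (hc : e.eval s = 0) :
    Within (.loop e p) (e.weight s + 1) s s := by
  intro B hB
  have h2 := Expr.cost_le hB e
  refine ⟨hB.mono (by omega), _, ?_, .loop_done hc⟩
  nlinarith

theorem Within.loop_step {e : Expr} {p : Prog} {u v : ℕ} {s s' s'' : State} (hc : e.eval s ≠ 0)
    (h : Within p u s s') (h' : Within (.loop e p) v s' s'') :
    Within (.loop e p) (e.weight s + 1 + u + v) s s'' := by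
  intro B hB
  obtain ⟨h1, t, ht, he⟩ := h B hB
  obtain ⟨h2, t', ht', he'⟩ := h' _ h1
  have h3 := Expr.cost_le hB e
  refine ⟨h2.mono (by omega), _, ?_, .loop_step hc he he'⟩
  generalize e.weight s = w at *
  have i1 : w * (B + w + 1) ≤ w * (B + (w + 1 + u + v) + 1) := Nat.mul_le_mul_left _ (by omega)
  have i2 : u * (B + u + 1) ≤ u * (B + (w + 1 + u + v) + 1) := Nat.mul_le_mul_left _ (by omega)
  have i3 : v * (B + u + v + 1) ≤ v * (B + (w + 1 + u + v) + 1) :=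
    Nat.mul_le_mul_left _ (by omega)
  have i4 : (w + 1 + u + v) * (B + (w + 1 + u + v) + 1) = w * (B + (w + 1 + u + v) + 1) +
    (B + (w + 1 + u + v) + 1) + u * (B + (w + 1 + u + v) + 1) +
    v * (B + (w + 1 + u + v) + 1) := by ring
  omega

/-- Started in `s`, the program `p` halts with weight at most `u` in a state satisfying `Q`. -/
def Wp (p : Prog) (u : ℕ) (Q : State → Prop) (s : State) : Prop :=
  ∃ s', Within p u s s' ∧ Q s'

theorem Wp.imp {p : Prog} {u v : ℕ} {Q R : State → Prop} {s : State} (h : Wp p u Q s)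
    (huv : u ≤ v) (hQR : ∀ s', Q s' → R s') : Wp p v R s := by
  obtain ⟨s', h1, h2⟩ := h
  exact ⟨s', h1.mono huv, hQR s' h2⟩

theorem Wp.skip {u : ℕ} {Q : State → Prop} {s : State} (hu : 1 ≤ u) (h : Q s) :
    Wp .skip u Q s := ⟨s, (Within.skip s).mono hu, h⟩

theorem Wp.assign {x : ℕ} {e : Expr} {u : ℕ} {Q : State → Prop} {s : State}
    (hu : e.weight s + 1 ≤ u) (h : Q (s.set x (e.eval s))) : Wp (.assign x e) u Q s :=
  ⟨_, (Within.assign x e s).mono hu, h⟩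

theorem Wp.store {a e : Expr} {u : ℕ} {Q : State → Prop} {s : State}
    (hu : a.weight s + e.weight s + 1 ≤ u) (h : Q (s.put (a.eval s) (e.eval s))) :
    Wp (.store a e) u Q s :=
  ⟨_, (Within.store a e s).mono hu, h⟩

theorem Wp.seq {p q : Prog} {u v : ℕ} {Q : State → Prop} {s : State}
    (h : Wp p u (Wp q v Q) s) : Wp (.seq p q) (u + v) Q s := by
  obtain ⟨s', h1, s'', h2, h3⟩ := h
  exact ⟨s'', h1.seq h2, h3⟩

theorem Wp.cond {e : Expr} {p q : Prog} {u v : ℕ} {Q : State → Prop} {s : State}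
    (hu : e.weight s + 1 ≤ u) (hp : e.eval s ≠ 0 → Wp p v Q s) (hq : e.eval s = 0 → Wp q v Q s) :
    Wp (.cond e p q) (u + v) Q s := by
  by_cases hc : e.eval s = 0
  · obtain ⟨s', h1, h2⟩ := hq hc
    exact ⟨s', (Within.cond_false hc h1).mono (by omega), h2⟩
  · obtain ⟨s', h1, h2⟩ := hp hc
    exact ⟨s', (Within.cond_true hc h1).mono (by omega), h2⟩

/-- `for x < y do p`, with registers `x` and `y`. -/
def Prog.forLoop (x y : ℕ) (p : Prog) : Prog :=
  .seq (.assign x (.const 0)) (.loop (.bin .lt (.reg x) (.reg y))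
    (.seq p (.assign x (.bin .add (.reg x) (.const 1)))))

/-- Each pass pays 4 for the test and 5 for the increment on top of the body; the initial assignment
and the failing last test make up the 6. The invariant after a pass refers to the state in which the
counter has been advanced. -/
theorem Wp.forLoop {x y : ℕ} {p : Prog} {u : ℕ} {s : State} (I : ℕ → State → Prop) (n : ℕ)
    (hxy : x ≠ y) (hy : s.reg y = n) (h0 : I 0 (s.set x 0))
    (hI : ∀ i < n, ∀ s, I i s → s.reg x = i → s.reg y = n →
      Wp p u (fun s' => s'.reg x = i ∧ s'.reg y = n ∧ I (i + 1) (s'.set x (i + 1))) s) :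
    Wp (Prog.forLoop x y p) (n * (u + 9) + 6) (I n) s := by
  have key : ∀ d i, i + d = n → ∀ s, I i s → s.reg x = i → s.reg y = n →
      Wp (.loop (.bin .lt (.reg x) (.reg y))
        (.seq p (.assign x (.bin .add (.reg x) (.const 1))))) (d * (u + 9) + 4) (I n) s := by
    intro d
    induction d with
    | zero =>
      intro i hi s hs h1 h2
      obtain rfl : i = n := hi
      refine ⟨s, (Within.loop_done (by simp [Expr.eval, Op.eval, h1, h2])).mono ?_, hs⟩
      simp [Expr.weight, Op.extra]
    | succ d ih =>
      intro i hi s hs h1 h2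
      obtain ⟨s', hw, h3, h4, h5⟩ := hI i (by omega) s hs h1 h2
      have hw' := Within.assign x (.bin .add (.reg x) (.const 1)) s'
      simp only [Expr.eval, Op.eval, h3] at hw'
      obtain ⟨s'', hw'', h6⟩ := ih (i + 1) (by omega) _ h5 (by simp) (by simp [hxy.symm, h4])
      refine ⟨s'', (Within.loop_step ?_ (hw.seq hw') hw'').mono ?_, h6⟩
      · simp only [Expr.eval, Op.eval, h1, h2]
        rw [if_pos (by omega)]
        norm_num
      · simp only [Expr.weight, Op.extra, Nat.add_mul]
        omega
  have h := Wp.seq (p := .assign x (.const 0)) (s := s) (u := 2) (Q := I n)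
    (Wp.assign (by simp [Expr.weight]) (key n 0 (by omega) _ h0 (by simp [Expr.eval])
      (by simp [hxy.symm, hy])))
  exact h.imp (by omega) fun _ h => h

theorem size_le_inputSize {l : List ℕ} {x : ℕ} (hx : x ∈ l) : Nat.size x ≤ inputSize l := by
  have : Nat.size x + 1 ∈ l.map fun x => Nat.size x + 1 := List.mem_map.2 ⟨x, hx, rfl⟩
  exact (Nat.le_succ _).trans (List.single_le_sum (by simp) _ this)

theorem length_le_inputSize (l : List ℕ) : l.length ≤ inputSize l := by
  induction l with
  | nil => simp
  | cons a l ih =>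
    simp only [inputSize, List.map_cons, List.sum_cons, List.length_cons] at *
    omega

theorem init_bdd (l : List ℕ) : (init l).Bdd (inputSize l) := by
  refine ⟨fun x => ?_, fun i => ?_⟩
  · simp only [init]
    split_ifs
    · exact (size_le_self _).trans (length_le_inputSize l)
    · simp
  · simp only [init, List.getD_eq_getElem?_getD]
    rcases lt_or_ge i l.length with h | h
    · simpa [h] using size_le_inputSize (List.getElem_mem h)
    · simp [h]

theorem Wp.exec {p : Prog} {u : ℕ} {Q : State → Prop} {l : List ℕ} (h : Wp p u Q (init l)) :
    ∃ s t, Exec p (init l) s t ∧ t ≤ u * (inputSize l + u + 1) ∧ Q s := by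
  obtain ⟨s, h1, h2⟩ := h
  obtain ⟨-, t, ht, he⟩ := h1 _ (init_bdd l)
  exact ⟨s, t, he, ht, h2⟩

end RAM

/-! ### P₄-free graphs: splittings and twins -/

section Cograph

variable {V : Type*} [DecidableEq V]

/-- Every path `a b c d` has one of the three possible chords. -/
def NoInducedP4 (G : SimpleGraph V) : Prop :=
  ∀ a b c d, G.Adj a b → G.Adj b c → G.Adj c d → ¬ G.Adj a c → ¬ G.Adj b d → G.Adj a d

omit [DecidableEq V] in
theorem IsFree.noInducedP4 {G : SimpleGraph V} (h : IsFree (SimpleGraph.pathGraph 4) G) :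
    NoInducedP4 G := by
  intro a b c d hab hbc hcd hac hbd
  by_contra had
  have nab := hab.ne
  have nbc := hbc.ne
  have ncd := hcd.ne
  have nac : a ≠ c := by rintro rfl; exact had hcd
  have nbd : b ≠ d := by rintro rfl; exact had hab
  have nad : a ≠ d := by rintro rfl; exact hac hcd.symm
  refine h ⟨⟨⟨![a, b, c, d], ?_⟩, ?_⟩⟩
  · intro i j hij
    fin_cases i <;> fin_cases j <;> simp_all
  · intro i j
    change G.Adj (![a, b, c, d] i) (![a, b, c, d] j) ↔ _
    have := hab.symm
    have := hbc.symm
    have := hcd.symm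
    have : ¬ G.Adj c a := fun h => hac h.symm
    have : ¬ G.Adj d b := fun h => hbd h.symm
    have : ¬ G.Adj d a := fun h => had h.symm
    fin_cases i <;> fin_cases j <;> simp_all [SimpleGraph.pathGraph_adj]

omit [DecidableEq V] in
-- The path on four vertices is self-complementary: an induced path `a b c d` in the complement is
-- an induced path `c a d b` in the graph.
theorem NoInducedP4.compl {G : SimpleGraph V} (h : NoInducedP4 G) : NoInducedP4 Gᶜ := by
  intro a b c d hab hbc hcd hac hbd
  simp only [SimpleGraph.compl_adj, not_and, not_not] at *
  by_cases nac : a = c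
  · rwa [nac]
  by_cases nbd : b = d
  · rwa [← nbd]
  refine ⟨?_, fun had => hbc.2 (h c a d b (hac nac).symm had (hbd nbd).symm hcd.2 hab.2).symm⟩
  rintro rfl
  exact hcd.2 (hac nac).symm

/-- `U` is the union of two disjoint nonempty parts, with all or no edges between them. -/
def Splits (G : SimpleGraph V) (U : Finset V) : Prop :=
  ∃ A B : Finset V, A.Nonempty ∧ B.Nonempty ∧ Disjoint A B ∧ A ∪ B = U ∧
    ((∀ x ∈ A, ∀ y ∈ B, G.Adj x y) ∨ ∀ x ∈ A, ∀ y ∈ B, ¬ G.Adj x y)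

theorem Splits.of_compl {G : SimpleGraph V} {U : Finset V} (h : Splits Gᶜ U) : Splits G U := by
  obtain ⟨A, B, hA, hB, hd, hU, h⟩ := h
  have hne : ∀ x ∈ A, ∀ y ∈ B, x ≠ y := fun x hx y hy => Finset.disjoint_iff_ne.1 hd x hx y hy
  refine ⟨A, B, hA, hB, hd, hU, h.symm.imp (fun h x hx y hy => ?_) (fun h x hx y hy => ?_)⟩
  · have := h x hx y hy
    simp only [SimpleGraph.compl_adj, not_and, not_not] at this
    exact this (hne x hx y hy)
  · exact (h x hx y hy).2

/-- The non-neighbours of `v` in `A` can be split off: an edge from such a vertex `a` to a neighbour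
`b ∈ A` of `v` would give an induced path `a b v z`, with `z` a neighbour of `v` in `B`. -/
theorem NoInducedP4.splits_insert_of_not_adj {G : SimpleGraph V} (hG : NoInducedP4 G) {v x : V}
    {A B : Finset V} (hvA : v ∉ A) (hvB : v ∉ B) (hd : Disjoint A B)
    (h : ∀ x ∈ A, ∀ y ∈ B, ¬ G.Adj x y) (hx : x ∈ A) (hvx : ¬ G.Adj v x)
    (hB : ∃ z ∈ B, G.Adj v z) : Splits G (insert v (A ∪ B)) := by
  classical
  obtain ⟨z, hz, hvz⟩ := hB
  refine ⟨A.filter (fun x => ¬ G.Adj v x), insert v (A.filter (fun x => G.Adj v x) ∪ B),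
    ⟨x, by simp [hx, hvx]⟩, ⟨v, by simp⟩, ?_, ?_, Or.inr ?_⟩
  · rw [Finset.disjoint_left] at *
    intro a ha
    simp only [Finset.mem_filter, Finset.mem_insert, Finset.mem_union] at *
    rintro (rfl | h' | h')
    exacts [hvA ha.1, ha.2 h'.2, hd ha.1 h']
  · ext a
    simp only [Finset.mem_filter, Finset.mem_insert, Finset.mem_union]
    tauto
  · intro a ha b hb hab
    simp only [Finset.mem_filter, Finset.mem_insert, Finset.mem_union] at *
    obtain rfl | ⟨hb, hvb⟩ | hb := hb
    · exact ha.2 hab.symm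
    · exact h a ha.1 z hz (hG a b v z hab hvb.symm hvz (fun h' => ha.2 h'.symm) (h b hb z hz))
    · exact h a ha.1 b hb hab

theorem NoInducedP4.splits_insert {G : SimpleGraph V} (hG : NoInducedP4 G) {v : V}
    {A B : Finset V} (hvA : v ∉ A) (hvB : v ∉ B) (hA : A.Nonempty) (hB : B.Nonempty)
    (hd : Disjoint A B) (h : ∀ x ∈ A, ∀ y ∈ B, ¬ G.Adj x y) : Splits G (insert v (A ∪ B)) := by
  by_cases h1 : ∃ z ∈ A, G.Adj v z
  swap
  · push Not at h1
    refine ⟨A, insert v B, hA, ⟨v, by simp⟩, by simp [hvA, hd], by simp, Or.inr ?_⟩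
    intro x hx y hy
    obtain rfl | hy := Finset.mem_insert.1 hy
    exacts [fun h' => h1 x hx h'.symm, h x hx y hy]
  by_cases h2 : ∃ z ∈ B, G.Adj v z
  swap
  · push Not at h2
    refine ⟨insert v A, B, ⟨v, by simp⟩, hB, by simp [hvB, hd], by simp, Or.inr ?_⟩
    intro x hx y hy
    obtain rfl | hx := Finset.mem_insert.1 hx
    exacts [h2 y hy, h x hx y hy]
  by_cases h3 : ∃ x ∈ A, ¬ G.Adj v x
  · obtain ⟨x, hx, hvx⟩ := h3
    exact hG.splits_insert_of_not_adj hvA hvB hd h hx hvx h2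
  by_cases h4 : ∃ x ∈ B, ¬ G.Adj v x
  · obtain ⟨x, hx, hvx⟩ := h4
    rw [Finset.union_comm]
    exact hG.splits_insert_of_not_adj hvB hvA hd.symm
      (fun x hx y hy h' => h y hy x hx h'.symm) hx hvx h1
  push Not at h3 h4
  refine ⟨{v}, A ∪ B, by simp, hA.mono Finset.subset_union_left, by simp [hvA, hvB], rfl,
    Or.inl ?_⟩
  simp only [Finset.mem_singleton, Finset.mem_union]
  rintro x rfl y (hy | hy)
  exacts [h3 y hy, h4 y hy]

/-- Vertices are added one at a time. A splitting with all edges present is treated in the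
complement, so only the case without edges between the parts needs an argument. -/
theorem NoInducedP4.splits {G : SimpleGraph V} (hG : NoInducedP4 G) {U : Finset V}
    (hU : 2 ≤ U.card) : Splits G U := by
  induction U using Finset.induction_on with
  | empty => simp at hU
  | insert v U hv ih =>
    rw [Finset.card_insert_of_notMem hv] at hU
    obtain h1 | h1 : U.card = 1 ∨ 2 ≤ U.card := by omega
    · obtain ⟨u, rfl⟩ := Finset.card_eq_one.1 h1
      refine ⟨{v}, {u}, by simp, by simp, by simpa using hv, rfl, ?_⟩
      simpa using em (G.Adj v u)
    · obtain ⟨A, B, hA, hB, hd, rfl, h | h⟩ := ih h1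
      · simp only [Finset.mem_union, not_or] at hv
        refine (hG.compl.splits_insert hv.1 hv.2 hA hB hd fun x hx y hy => ?_).of_compl
        simp [h x hx y hy]
      · simp only [Finset.mem_union, not_or] at hv
        exact hG.splits_insert hv.1 hv.2 hA hB hd h

/-- `i` and `j` have the same neighbours in `U`, apart from `i` and `j` themselves. -/
def Twins (G : SimpleGraph V) (U : Finset V) (i j : V) : Prop :=
  i ∈ U ∧ j ∈ U ∧ i ≠ j ∧ ∀ k ∈ U, k ≠ i → k ≠ j → (G.Adj i k ↔ G.Adj j k)

omit [DecidableEq V] in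
theorem Twins.symm {G : SimpleGraph V} {U : Finset V} {i j : V} (h : Twins G U i j) :
    Twins G U j i :=
  ⟨h.2.1, h.1, h.2.2.1.symm, fun k hk h1 h2 => (h.2.2.2 k hk h2 h1).symm⟩

theorem Twins.union {G : SimpleGraph V} {A B : Finset V} {i j : V} (h : Twins G A i j)
    (hAB : (∀ x ∈ A, ∀ y ∈ B, G.Adj x y) ∨ ∀ x ∈ A, ∀ y ∈ B, ¬ G.Adj x y) :
    Twins G (A ∪ B) i j := by
  obtain ⟨hi, hj, hij, hk⟩ := h
  refine ⟨by simp [hi], by simp [hj], hij, fun k hk' h1 h2 => ?_⟩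
  rcases Finset.mem_union.1 hk' with hk' | hk'
  · exact hk k hk' h1 h2
  · rcases hAB with h | h
    · simp [h i hi k hk', h j hj k hk']
    · simp [h i hi k hk', h j hj k hk']

/-- Twins inside one part of a splitting remain twins in the whole, since every vertex of the other
part sees both or neither. If both parts are single vertices, these two are twins vacuously. -/
theorem NoInducedP4.exists_twins {G : SimpleGraph V} (hG : NoInducedP4 G) {U : Finset V}
    (hU : 2 ≤ U.card) : ∃ i j, Twins G U i j := by
  induction U using Finset.strongInduction with
  | H U ih =>
    obtain ⟨A, B, hA, hB, hd, rfl, h⟩ := hG.splits hU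
    have hAB := Finset.card_union_of_disjoint hd
    have := hA.card_pos
    have := hB.card_pos
    by_cases h1 : 2 ≤ A.card
    · obtain ⟨i, j, hij⟩ := ih A 
        (Finset.ssubset_iff_subset_ne.2 ⟨Finset.subset_union_left, fun h' => by
          rw [← h'] at hAB; omega⟩) h1
      exact ⟨i, j, hij.union h⟩
    by_cases h2 : 2 ≤ B.card
    · obtain ⟨i, j, hij⟩ := ih B 
        (Finset.ssubset_iff_subset_ne.2 ⟨Finset.subset_union_right, fun h' => by
          rw [← h'] at hAB; omega⟩) h2
      refine ⟨i, j, ?_⟩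
      rw [Finset.union_comm]
      exact hij.union (h.imp (fun h x hx y hy => (h y hy x hx).symm)
        (fun h x hx y hy h' => h y hy x hx h'.symm))
    obtain ⟨a, rfl⟩ := Finset.card_eq_one.1 (show A.card = 1 by omega)
    obtain ⟨b, rfl⟩ := Finset.card_eq_one.1 (show B.card = 1 by omega)
    refine ⟨a, b, by simp, by simp, by simpa using hd, ?_⟩
    intro k hk h1 h2
    simp at hk
    tauto

end Cograph

/-! ### Reducing odd cycles through `T` to triangles and 5-cycles -/

section Transversal

variable {V : Type*} [DecidableEq V]

/-- No vertex of `T` lies on a triangle or a (not necessarily induced) 5-cycle inside `F`. -/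
def NoShortOddCycle (G : SimpleGraph V) (T F : Finset V) : Prop :=
  (∀ t ∈ F, t ∈ T → ∀ a ∈ F, ∀ b ∈ F, G.Adj t a → G.Adj a b → ¬ G.Adj b t) ∧
  ∀ t ∈ F, t ∈ T → ∀ a ∈ F, ∀ b ∈ F, ∀ c ∈ F, ∀ d ∈ F, G.Adj t a → G.Adj a b → G.Adj b c →
    G.Adj c d → G.Adj d t → ¬ [t, a, b, c, d].Nodup

omit [DecidableEq V] in
theorem SimpleGraph.Walk.support_subset_of_closed {G : SimpleGraph V} {A : Set V} {u v : V}
    (p : G.Walk u v) (hu : u ∈ A) (hA : ∀ x ∈ p.support, ∀ y ∈ p.support, x ∈ A → G.Adj x y → y ∈ A) :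
    ∀ x ∈ p.support, x ∈ A := by
  induction p with
  | nil => simpa using hu
  | cons h p ih =>
    simp only [SimpleGraph.Walk.support_cons, List.mem_cons] at *
    have := ih (hA _ (Or.inl rfl) _ (Or.inr p.start_mem_support) hu h)
      (fun x hx y hy => hA x (Or.inr hx) y (Or.inr hy))
    rintro x (rfl | hx)
    exacts [hu, this x hx]

omit [DecidableEq V] in
theorem SimpleGraph.Walk.even_length_iff_of_bipartition {G : SimpleGraph V} {A : Set V} {u v : V}
    (p : G.Walk u v) (hA : ∀ x ∈ p.support, ∀ y ∈ p.support, G.Adj x y → (x ∈ A ↔ y ∉ A)) :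
    Even p.length ↔ (u ∈ A ↔ v ∈ A) := by
  induction p with
  | nil => simp
  | cons h p ih =>
    simp only [SimpleGraph.Walk.support_cons, List.mem_cons, SimpleGraph.Walk.length_cons,
      Nat.even_add_one] at *
    rw [ih (fun x hx y hy => hA x (Or.inr hx) y (Or.inr hy))]
    have := hA _ (Or.inl rfl) _ (Or.inr p.start_mem_support) h
    tauto

theorem NoInducedP4.isOddCycleTransversal {G : SimpleGraph V} [Fintype V] (hG : NoInducedP4 G)
    {T F : Finset V} (hF : NoShortOddCycle G T F) :
    IsOddCycleTransversal G (T : Set V) ((Fᶜ : Finset V) : Set V) := by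
  intro v c hc hodd ⟨t, htT, htc⟩
  by_contra hS
  have hcF : ∀ x ∈ c.support, x ∈ F := by
    intro x hx
    by_contra hxF
    exact hS ⟨x, by simpa using hxF, hx⟩
  -- The cycle is rotated to start at `t`, so that its second and its penultimate vertex are two
  -- distinct neighbours of `t`.
  replace hc := hc.rotate htc
  have hodd' : Odd (c.rotate t htc).length := by simpa using hodd
  replace hcF : ∀ x ∈ (c.rotate t htc).support, x ∈ F := fun x hx =>
    hcF x ((c.mem_support_rotate_iff t htc).1 hx)
  generalize c.rotate t htc = p at *
  clear hodd hS htc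
  have htF := hcF t p.start_mem_support
  have hT : t ∈ T := htT
  have hnil : ¬ p.Nil := hc.not_nil
  have hsnd := p.adj_snd hnil
  have hpen := p.adj_penultimate hnil
  have hne := hc.snd_ne_penultimate
  have msnd : p.snd ∈ p.support := p.getVert_mem_support _
  have mpen : p.penultimate ∈ p.support := p.getVert_mem_support _
  have hX : 2 ≤ p.support.toFinset.card := by
    refine Finset.one_lt_card.2 ⟨t, ?_, p.snd, ?_, hsnd.ne⟩ <;> simp
  have key : ∀ A B : Finset V, t ∈ A → B.Nonempty → Disjoint A B → A ∪ B = p.support.toFinset →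
      ((∀ x ∈ A, ∀ y ∈ B, G.Adj x y) ∨ ∀ x ∈ A, ∀ y ∈ B, ¬ G.Adj x y) → False := by
    intro A B htA ⟨b, hb⟩ hd hAB h
    have hsupp : ∀ x, x ∈ p.support ↔ x ∈ A ∨ x ∈ B := by
      intro x
      rw [← List.mem_toFinset, ← hAB, Finset.mem_union]
    have hdj : ∀ x, x ∈ A → x ∉ B := fun x hx => Finset.disjoint_left.1 hd hx
    have hF' : ∀ x, x ∈ A ∨ x ∈ B → x ∈ F := fun x hx => hcF x ((hsupp x).2 hx)
    rcases h with h | h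
    -- In a join, excluding triangles at `t` makes `B` independent and leaves `t` without neighbours
    -- in `A`. Both cycle neighbours of `t` then lie in `B`; an edge `x y` inside `A` closes a
    -- 5-cycle with them and `t`, and without such an edge the cycle is bipartite, hence even.
    · have hB : ∀ x ∈ B, ∀ y ∈ B, ¬ G.Adj x y := fun x hx y hy hxy =>
        hF.1 t htF hT x (hF' x (Or.inr hx)) y (hF' y (Or.inr hy)) (h t htA x hx) hxy (h t htA y hy).symm
      have ht : ∀ x ∈ A, ¬ G.Adj t x := fun x hx htx =>
        hF.1 t htF hT x (hF' x (Or.inl hx)) b (hF' b (Or.inr hb)) htx (h x hx b hb) (h t htA b hb).symm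
      have hsndB : p.snd ∈ B := ((hsupp _).1 msnd).resolve_left (fun h' => ht _ h' hsnd)
      have hpenB : p.penultimate ∈ B := ((hsupp _).1 mpen).resolve_left fun h' => ht _ h' hpen.symm
      by_cases hA : ∃ x ∈ A, ∃ y ∈ A, G.Adj x y
      · obtain ⟨x, hx, y, hy, hxy⟩ := hA
        refine hF.2 t htF hT _ (hF' _ (Or.inr hsndB)) x (hF' x (Or.inl hx)) y (hF' y (Or.inl hy)) _
          (hF' _ (Or.inr hpenB)) hsnd (h x hx _ hsndB).symm hxy (h y hy _ hpenB) hpen ?_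
        have n1 : t ≠ x := by rintro rfl; exact ht y hy hxy
        have n2 : t ≠ y := by rintro rfl; exact ht x hx hxy.symm
        have n3 := (h x hx _ hsndB).ne
        have n4 := (h y hy _ hsndB).ne
        have n5 := (h x hx _ hpenB).ne
        have n6 := (h y hy _ hpenB).ne
        have n7 := hsnd.ne
        have n8 := hpen.ne
        have n9 := hxy.ne
        simp only [List.nodup_cons, List.mem_cons, List.not_mem_nil, or_false, not_or,
          List.nodup_nil, not_false_eq_true, and_true]
        exact ⟨⟨n7, n1, n2, n8.symm⟩, ⟨n3.symm, n4.symm, hne⟩, ⟨n9, n5⟩, n6⟩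
      · push Not at hA
        have := p.even_length_iff_of_bipartition (A := (A : Set V)) (by
          intro x hx y hy hxy
          rw [hsupp] at hx hy
          have h1 := hA x
          have h2 := hB x
          have h3 := hdj x
          have h4 := hdj y
          simp only [Finset.mem_coe]
          constructor
          · intro hx' hy'
            exact h1 hx' y hy' hxy
          · intro hy'
            by_contra hx'
            exact h2 (hx.resolve_left hx') y (hy.resolve_left hy') hxy)
        simp only [iff_true] at this
        exact Nat.not_even_iff_odd.2 hodd' this
    -- Without edges between the parts the cycle can never leave `A`, although it visits all of the
    -- nonempty `B`.
    · have := p.support_subset_of_closed (A := (A : Set V)) htA (by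
        intro x hx y hy hxA hxy
        rw [hsupp] at hy
        exact hy.resolve_right fun hy' => h x hxA y hy' hxy)
      exact hdj b (this b ((hsupp b).2 (Or.inr hb))) hb
  obtain ⟨A, B, hA, hB, hd, hAB, h⟩ := hG.splits hX
  have ht : t ∈ A ∪ B := by rw [hAB]; simp
  rcases Finset.mem_union.1 ht with ht | ht
  · exact key A B ht hB hd hAB h
  · exact key B A ht hA hd.symm (by rw [Finset.union_comm, hAB])
      (h.imp (fun h x hx y hy => (h y hy x hx).symm) (fun h x hx y hy h' => h y hy x hx h'.symm))

omit [DecidableEq V] in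
theorem IsOddCycleTransversal.noShortOddCycle {G : SimpleGraph V} {T F : Finset V} {S : Set V}
    (h : IsOddCycleTransversal G (T : Set V) S) (hF : ∀ v ∈ F, v ∉ S) : NoShortOddCycle G T F := by
  refine ⟨fun t htF htT a ha b hb hta hab hbt => ?_,
    fun t htF htT a ha b hb c hc d hd hta hab hbc hcd hdt hn => ?_⟩
  · obtain ⟨s, hs, hs'⟩ := h t (.cons hta (.cons hab (.cons hbt .nil)))
      (by
        have := hta.ne
        have := hab.ne
        have := hbt.ne
        simp [SimpleGraph.Walk.cons_isCycle_iff, SimpleGraph.Walk.cons_isPath_iff]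
        grind) (by simp; decide) ⟨t, htT, by simp⟩
    simp at hs'
    rcases hs' with rfl | rfl | rfl | rfl <;> simp_all
  · obtain ⟨s, hs, hs'⟩ := h t (.cons hta (.cons hab (.cons hbc (.cons hcd (.cons hdt .nil)))))
      (by
        simp [SimpleGraph.Walk.cons_isCycle_iff, SimpleGraph.Walk.cons_isPath_iff] at hn ⊢
        grind) (by simp; decide) ⟨t, htT, by simp⟩
    simp at hs'
    rcases hs' with rfl | rfl | rfl | rfl | rfl | rfl <;> simp_all

end Transversal

/-! ### Maximum weight of a subset with a given property -/

section Best

variable {V : Type*} [DecidableEq V]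

open Classical in
/-- The maximum weight of a subset of `X` with the property `P`. -/
noncomputable def best (W : V → ℕ) (P : Finset V → Prop) (X : Finset V) : ℕ :=
  (X.powerset.filter P).sup fun F => ∑ v ∈ F, W v

variable {W : V → ℕ} {P Q R : Finset V → Prop} {A B X F : Finset V}

omit [DecidableEq V] in
theorem le_best (hF : F ⊆ X) (hP : P F) : ∑ v ∈ F, W v ≤ best W P X := by
  classical
  exact Finset.le_sup (f := fun F => ∑ v ∈ F, W v) (by simp [hF, hP])

omit [DecidableEq V] in
theorem best_le {c : ℕ} (h : ∀ F ⊆ X, P F → ∑ v ∈ F, W v ≤ c) : best W P X ≤ c := by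
  classical
  exact Finset.sup_le fun F hF => by
    simp only [Finset.mem_filter, Finset.mem_powerset] at hF
    exact h F hF.1 hF.2

omit [DecidableEq V] in
theorem exists_best (h : P ∅) : ∃ F ⊆ X, P F ∧ ∑ v ∈ F, W v = best W P X := by
  classical
  obtain ⟨F, hF, h⟩ := Finset.exists_mem_eq_sup (X.powerset.filter P) ⟨∅, by simp [h]⟩
    fun F => ∑ v ∈ F, W v
  simp only [Finset.mem_filter, Finset.mem_powerset] at hF
  exact ⟨F, hF.1, hF.2, h.symm⟩

omit [DecidableEq V] in
theorem best_le_best (hAX : A ⊆ X) (h : ∀ F ⊆ A, P F → Q F) : best W P A ≤ best W Q X :=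
  best_le fun F hF hP => le_best (hF.trans hAX) (h F hF hP)

theorem best_add_best_le (hd : Disjoint A B) (hP : P ∅) (hQ : Q ∅)
    (h : ∀ F ⊆ A, ∀ F' ⊆ B, P F → Q F' → R (F ∪ F')) :
    best W P A + best W Q B ≤ best W R (A ∪ B) := by
  obtain ⟨F, hF, hPF, h1⟩ := exists_best (W := W) (X := A) hP
  obtain ⟨F', hF', hQF, h2⟩ := exists_best (W := W) (X := B) hQ
  rw [← h1, ← h2, ← Finset.sum_union (Finset.disjoint_of_subset_left hF
    (Finset.disjoint_of_subset_right hF' hd))]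
  exact le_best (Finset.union_subset_union hF hF') (h F hF F' hF' hPF hQF)

theorem best_union_le {c : ℕ} (hd : Disjoint A B)
    (h : ∀ F ⊆ A, ∀ F' ⊆ B, P (F ∪ F') → ∑ v ∈ F, W v + ∑ v ∈ F', W v ≤ c) :
    best W P (A ∪ B) ≤ c := by
  refine best_le fun F hF hP => ?_
  have hF' : F ∩ A ∪ F ∩ B = F := by
    rw [← Finset.inter_union_distrib_left]
    exact Finset.inter_eq_left.2 hF
  have := h (F ∩ A) Finset.inter_subset_right (F ∩ B) Finset.inter_subset_right (by rwa [hF'])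
  rwa [← Finset.sum_union (Finset.disjoint_of_subset_left Finset.inter_subset_right
    (Finset.disjoint_of_subset_right Finset.inter_subset_right hd)), hF'] at this

/-- `P` passes to subsets. -/
def Hereditary (P : Finset V → Prop) : Prop := P ∅ ∧ ∀ F F' : Finset V, F ⊆ F' → P F' → P F

theorem best_union (hd : Disjoint A B) (hP : Hereditary P)
    (h : ∀ F ⊆ A, ∀ F' ⊆ B, P F → P F' → P (F ∪ F')) :
    best W P (A ∪ B) = best W P A + best W P B :=
  le_antisymm (best_union_le hd fun _ hF _ hF' hP' =>
    add_le_add (le_best hF (hP.2 _ _ Finset.subset_union_left hP'))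
      (le_best hF' (hP.2 _ _ Finset.subset_union_right hP')))
    (best_add_best_le hd hP.1 hP.1 h)

theorem best_union_max (hd : Disjoint A B) (hP : Hereditary P)
    (h : ∀ F ⊆ A, ∀ F' ⊆ B, P (F ∪ F') → F = ∅ ∨ F' = ∅) :
    best W P (A ∪ B) = max (best W P A) (best W P B) := by
  refine le_antisymm (best_union_le hd fun F hF F' hF' hP' => ?_)
    (max_le (best_le_best Finset.subset_union_left fun _ _ h => h)
      (best_le_best Finset.subset_union_right fun _ _ h => h))
  have h1 := le_best (W := W) hF (hP.2 _ _ Finset.subset_union_left hP')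
  have h2 := le_best (W := W) hF' (hP.2 _ _ Finset.subset_union_right hP')
  rcases h F hF F' hF' hP' with rfl | rfl
  · simp at *; omega
  · simp at *; omega

end Best

/-! ### Recurrences for disjoint unions and joins -/

section Recurrences

variable {V : Type*} [DecidableEq V] (G : SimpleGraph V) (T : Finset V)

/-- `F` contains no vertex of `T`. -/
def Avoids (F : Finset V) : Prop := ∀ v ∈ F, v ∉ T

/-- `F` consists of at most one vertex, and this vertex is not in `T`. -/
def AvoidsSingle (F : Finset V) : Prop := Avoids T F ∧ F.card ≤ 1

/-- `F` is independent. -/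
def Indep (F : Finset V) : Prop := ∀ x ∈ F, ∀ y ∈ F, ¬ G.Adj x y

/-- The vertices of `T` in `F` are isolated in `G[F]`. -/
def IsolatesT (F : Finset V) : Prop := ∀ t ∈ F, t ∈ T → ∀ y ∈ F, ¬ G.Adj t y

variable {G T} {W : V → ℕ} {A B F F' : Finset V}

omit [DecidableEq V] in
theorem hereditary_avoids : Hereditary (Avoids T) :=
  ⟨by simp [Avoids], fun _ _ h h' v hv => h' v (h hv)⟩

omit [DecidableEq V] in
theorem hereditary_avoidsSingle : Hereditary (AvoidsSingle T) :=
  ⟨⟨hereditary_avoids.1, by simp⟩,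
    fun _ _ h h' => ⟨hereditary_avoids.2 _ _ h h'.1, (Finset.card_le_card h).trans h'.2⟩⟩

omit [DecidableEq V] in
theorem hereditary_indep : Hereditary (Indep G) :=
  ⟨by simp [Indep], fun _ _ h h' x hx y hy => h' x (h hx) y (h hy)⟩

omit [DecidableEq V] in
theorem hereditary_isolatesT : Hereditary (IsolatesT G T) :=
  ⟨by simp [IsolatesT], fun _ _ h h' x hx hT y hy => h' x (h hx) hT y (h hy)⟩

omit [DecidableEq V] in
theorem hereditary_noShortOddCycle : Hereditary (NoShortOddCycle G T) :=
  ⟨by simp [NoShortOddCycle], fun _ _ h h' =>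
    ⟨fun t ht hT a ha b hb => h'.1 t (h ht) hT a (h ha) b (h hb),
      fun t ht hT a ha b hb c hc d hd => h'.2 t (h ht) hT a (h ha) b (h hb) c (h hc) d (h hd)⟩⟩

theorem Avoids.union (h : Avoids T F) (h' : Avoids T F') : Avoids T (F ∪ F') := by
  intro v hv
  rcases Finset.mem_union.1 hv with hv | hv
  exacts [h v hv, h' v hv]

omit [DecidableEq V] in
theorem Avoids.isolatesT (h : Avoids T F) : IsolatesT G T F := fun t ht hT => absurd hT (h t ht)

omit [DecidableEq V] in
theorem IsolatesT.noShortOddCycle (h : IsolatesT G T F) : NoShortOddCycle G T F :=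
  ⟨fun t ht hT a ha _ _ hta => absurd hta (h t ht hT a ha),
    fun t ht hT a ha _ _ _ _ _ _ hta => absurd hta (h t ht hT a ha)⟩

theorem best_avoids_union (hd : Disjoint A B) :
    best W (Avoids T) (A ∪ B) = best W (Avoids T) A + best W (Avoids T) B :=
  best_union hd hereditary_avoids fun _ _ _ _ h h' => h.union h'

theorem best_avoidsSingle_union (hd : Disjoint A B) :
    best W (AvoidsSingle T) (A ∪ B) = max (best W (AvoidsSingle T) A) (best W (AvoidsSingle T) B) := by
  refine best_union_max hd hereditary_avoidsSingle fun F hF F' hF' h => ?_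
  have := h.2
  rw [Finset.card_union_of_disjoint (Finset.disjoint_of_subset_left hF
    (Finset.disjoint_of_subset_right hF' hd))] at this
  rw [← Finset.card_eq_zero, ← Finset.card_eq_zero]
  omega

section DisjointUnion

variable (hAB : ∀ x ∈ A, ∀ y ∈ B, ¬ G.Adj x y)
include hAB

theorem best_indep_union (hd : Disjoint A B) :
    best W (Indep G) (A ∪ B) = best W (Indep G) A + best W (Indep G) B := by
  refine best_union hd hereditary_indep fun F hF F' hF' h h' x hx y hy hxy => ?_
  rcases Finset.mem_union.1 hx with hx | hx <;> rcases Finset.mem_union.1 hy with hy | hy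
  exacts [h x hx y hy hxy, hAB x (hF hx) y (hF' hy) hxy, hAB y (hF hy) x (hF' hx) hxy.symm,
    h' x hx y hy hxy]

theorem best_isolatesT_union (hd : Disjoint A B) :
    best W (IsolatesT G T) (A ∪ B) = best W (IsolatesT G T) A + best W (IsolatesT G T) B := by
  refine best_union hd hereditary_isolatesT fun F hF F' hF' h h' x hx hT y hy hxy => ?_
  rcases Finset.mem_union.1 hx with hx | hx <;> rcases Finset.mem_union.1 hy with hy | hy
  exacts [h x hx hT y hy hxy, hAB x (hF hx) y (hF' hy) hxy, hAB y (hF hy) x (hF' hx) hxy.symm,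
    h' x hx hT y hy hxy]

theorem best_noShortOddCycle_union (hd : Disjoint A B) :
    best W (NoShortOddCycle G T) (A ∪ B) =
      best W (NoShortOddCycle G T) A + best W (NoShortOddCycle G T) B := by
  refine best_union hd hereditary_noShortOddCycle fun F hF F' hF' h h' => ?_
  have hl : ∀ x y, x ∈ F → y ∈ F ∪ F' → G.Adj x y → y ∈ F := fun x y hx hy hxy =>
    (Finset.mem_union.1 hy).resolve_right fun hy => hAB x (hF hx) y (hF' hy) hxy
  have hr : ∀ x y, x ∈ F' → y ∈ F ∪ F' → G.Adj x y → y ∈ F' := fun x y hx hy hxy =>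
    (Finset.mem_union.1 hy).resolve_left fun hy => hAB y (hF hy) x (hF' hx) hxy.symm
  refine ⟨fun t ht hT a ha b hb hta hab => ?_, fun t ht hT a ha b hb c hc d hd hta hab hbc hcd => ?_⟩
  · rcases Finset.mem_union.1 ht with ht | ht
    · have ha := hl t a ht ha hta
      exact h.1 t ht hT a ha b (hl a b ha hb hab) hta hab
    · have ha := hr t a ht ha hta
      exact h'.1 t ht hT a ha b (hr a b ha hb hab) hta hab
  · rcases Finset.mem_union.1 ht with ht | ht
    · have ha := hl t a ht ha hta
      have hb := hl a b ha hb hab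
      have hc := hl b c hb hc hbc
      exact h.2 t ht hT a ha b hb c hc d (hl c d hc hd hcd) hta hab hbc hcd
    · have ha := hr t a ht ha hta
      have hb := hr a b ha hb hab
      have hc := hr b c hb hc hbc
      exact h'.2 t ht hT a ha b hb c hc d (hr c d hc hd hcd) hta hab hbc hcd

end DisjointUnion

section Join

variable (hAB : ∀ x ∈ A, ∀ y ∈ B, G.Adj x y)
include hAB

theorem best_indep_join (hd : Disjoint A B) :
    best W (Indep G) (A ∪ B) = max (best W (Indep G) A) (best W (Indep G) B) := by
  refine best_union_max hd hereditary_indep fun F hF F' hF' h => ?_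
  by_contra! hne
  obtain ⟨⟨x, hx⟩, ⟨y, hy⟩⟩ := hne
  exact h x (by simp [hx]) y (by simp [hy]) (hAB x (hF hx) y (hF' hy))

/-- If both pieces are nonempty, every vertex has a neighbour on the other side, so no vertex of `T`
can occur at all. -/
theorem best_isolatesT_join (hd : Disjoint A B) :
    best W (IsolatesT G T) (A ∪ B) = max (max (best W (IsolatesT G T) A) (best W (IsolatesT G T) B))
      (best W (Avoids T) A + best W (Avoids T) B) := by
  refine le_antisymm (best_union_le hd fun F hF F' hF' h => ?_) (max_le (max_le ?_ ?_) ?_)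
  · rcases F.eq_empty_or_nonempty with rfl | ⟨x, hx⟩
    · rw [Finset.empty_union] at h
      have := le_best (W := W) hF' h
      simp
      omega
    rcases F'.eq_empty_or_nonempty with rfl | ⟨y, hy⟩
    · rw [Finset.union_empty] at h
      have := le_best (W := W) hF h
      simp
      omega
    · have h1 : Avoids T F := fun v hv hT =>
        h v (by simp [hv]) hT y (by simp [hy]) (hAB v (hF hv) y (hF' hy))
      have h2 : Avoids T F' := fun v hv hT =>
        h v (by simp [hv]) hT x (by simp [hx]) (hAB x (hF hx) v (hF' hv)).symm
      exact (add_le_add (le_best hF h1) (le_best hF' h2)).trans (le_max_right _ _)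
  · exact best_le_best Finset.subset_union_left fun _ _ h => h
  · exact best_le_best Finset.subset_union_right fun _ _ h => h
  · rw [← best_avoids_union hd]
    exact best_le_best subset_rfl fun _ _ h => h.isolatesT

omit hAB in
-- The union is bipartite: edges alternate between the two sides, so an odd closed walk would need
-- an edge inside one side.
theorem Indep.noShortOddCycle_union (h : Indep G F) (h' : Indep G F') :
    NoShortOddCycle G T (F ∪ F') := by
  have hl : ∀ x y, x ∈ F → y ∈ F ∪ F' → G.Adj x y → y ∈ F' := fun x y hx hy hxy =>
    (Finset.mem_union.1 hy).resolve_left fun hy => h x hx y hy hxy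
  have hr : ∀ x y, x ∈ F' → y ∈ F ∪ F' → G.Adj x y → y ∈ F := fun x y hx hy hxy =>
    (Finset.mem_union.1 hy).resolve_right fun hy => h' x hx y hy hxy
  refine ⟨fun t ht _ a ha b hb hta hab hbt => ?_,
    fun t ht _ a ha b hb c hc d hd hta hab hbc hcd hdt => ?_⟩
  · rcases Finset.mem_union.1 ht with ht | ht
    · exact h b (hr a b (hl t a ht ha hta) hb hab) t ht hbt
    · exact h' b (hl a b (hr t a ht ha hta) hb hab) t ht hbt
  · rcases Finset.mem_union.1 ht with ht | ht
    · have hb := hr a b (hl t a ht ha hta) hb hab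
      exact absurd hdt (h d (hr c d (hl b c hb hc hbc) hd hcd) t ht)
    · have hb := hl a b (hr t a ht ha hta) hb hab
      exact absurd hdt (h' d (hl c d (hr b c hb hc hbc) hd hcd) t ht)

omit hAB in
-- A vertex of `T` lies in `F` and can be adjacent only to the single vertex of `F'`, so it has
-- degree at most one and is on no cycle.
theorem IsolatesT.noShortOddCycle_union (h : IsolatesT G T F) (h' : AvoidsSingle T F') :
    NoShortOddCycle G T (F ∪ F') := by
  have key : ∀ t ∈ F ∪ F', t ∈ T → ∀ a ∈ F ∪ F', ∀ b ∈ F ∪ F', G.Adj t a → G.Adj t b → a = b := by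
    intro t ht hT a ha b hb hta htb
    have ht : t ∈ F := (Finset.mem_union.1 ht).resolve_right fun ht => h'.1 t ht hT
    have ha : a ∈ F' := (Finset.mem_union.1 ha).resolve_left fun ha => h t ht hT a ha hta
    have hb : b ∈ F' := (Finset.mem_union.1 hb).resolve_left fun hb => h t ht hT b hb htb
    exact Finset.card_le_one.1 h'.2 a ha b hb
  refine ⟨fun t ht hT a ha b hb hta hab hbt => ?_,
    fun t ht hT a ha b hb c hc d hd hta hab hbc hcd hdt hn => ?_⟩
  · exact hab.ne (key t ht hT a ha b hb hta hbt.symm)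
  · have := key t ht hT a ha d hd hta hdt.symm
    simp [this] at hn

omit [DecidableEq V] hAB in
theorem not_indep : ¬ Indep G F ↔ ∃ x ∈ F, ∃ y ∈ F, G.Adj x y := by
  simp [Indep]

/-- An edge `x y` in `F` forms a triangle with any `T`-vertex of `F'`, and an edge of `F` at a
`T`-vertex forms one with any vertex of `F'`. If `F'` has two vertices `c` and `d`, a `T`-vertex `t`
of `F` would lie on the 5-cycle `t c x y d`. -/
theorem NoShortOddCycle.join_cases_of_not_indep (hF : F ⊆ A) (hF' : F' ⊆ B)
    (hne : F'.Nonempty) (h : NoShortOddCycle G T (F ∪ F')) (hi : ¬ Indep G F) :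
    Avoids T (F ∪ F') ∨ IsolatesT G T F ∧ AvoidsSingle T F' := by
  obtain ⟨x, hx, y, hy, hxy⟩ := not_indep.1 hi
  have hj : ∀ a ∈ F, ∀ b ∈ F', G.Adj a b := fun a ha b hb => hAB a (hF ha) b (hF' hb)
  have hl : ∀ {a}, a ∈ F → a ∈ F ∪ F' := fun ha => Finset.mem_union_left _ ha
  have hr : ∀ {a}, a ∈ F' → a ∈ F ∪ F' := fun ha => Finset.mem_union_right _ ha
  have hT' : Avoids T F' := fun t ht hT =>
    h.1 t (hr ht) hT x (hl hx) y (hl hy) (hj x hx t ht).symm hxy (hj y hy t ht)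
  obtain ⟨b, hb⟩ := hne
  have hI : IsolatesT G T F := fun t ht hT z hz htz =>
    h.1 t (hl ht) hT z (hl hz) b (hr hb) htz (hj z hz b hb) (hj t ht b hb).symm
  by_cases hc : F'.card ≤ 1
  · exact Or.inr ⟨hI, hT', hc⟩
  refine Or.inl (Avoids.union (fun t ht hT => ?_) hT')
  obtain ⟨c, hc, d, hd', hcd⟩ := Finset.one_lt_card.1 (not_le.1 hc)
  have hne : ∀ a ∈ F, ∀ b ∈ F', a ≠ b := fun a ha b hb => (hj a ha b hb).ne
  have n1 : t ≠ x := by rintro rfl; exact hI t ht hT y hy hxy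
  have n2 : t ≠ y := by rintro rfl; exact hI t ht hT x hx hxy.symm
  refine h.2 t (hl ht) hT c (hr hc) x (hl hx) y (hl hy) d (hr hd') (hj t ht c hc)
    (hj x hx c hc).symm hxy (hj y hy d hd') (hj t ht d hd').symm ?_
  simp [hne t ht c hc, n1, n2, hne t ht d hd', (hne x hx c hc).symm, (hne y hy c hc).symm, hcd,
    hxy.ne, hne x hx d hd', hne y hy d hd']

theorem best_noShortOddCycle_join (hd : Disjoint A B) :
    best W (NoShortOddCycle G T) (A ∪ B) =
      max (max (max (max (max (best W (NoShortOddCycle G T) A) (best W (NoShortOddCycle G T) B))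
        (best W (Indep G) A + best W (Indep G) B))
        (best W (Avoids T) A + best W (Avoids T) B))
        (best W (IsolatesT G T) A + best W (AvoidsSingle T) B))
        (best W (IsolatesT G T) B + best W (AvoidsSingle T) A) := by
  refine le_antisymm (best_union_le hd fun F hF F' hF' h => ?_) ?_
  · simp only [le_max_iff]
    rcases F.eq_empty_or_nonempty with rfl | hne
    · rw [Finset.empty_union] at h
      have := le_best (W := W) hF' h
      simp [this]
    rcases F'.eq_empty_or_nonempty with rfl | hne'
    · rw [Finset.union_empty] at h
      have := le_best (W := W) hF h
      simp [this]
    have hav : Avoids T (F ∪ F') → ∑ v ∈ F, W v + ∑ v ∈ F', W v ≤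
        best W (Avoids T) A + best W (Avoids T) B := fun h' =>
      add_le_add (le_best hF (hereditary_avoids.2 _ _ Finset.subset_union_left h'))
        (le_best hF' (hereditary_avoids.2 _ _ Finset.subset_union_right h'))
    by_cases h1 : Indep G F
    · by_cases h2 : Indep G F'
      · have := add_le_add (le_best (W := W) hF h1) (le_best (W := W) hF' h2)
        simp [this]
      · rw [Finset.union_comm] at h
        rcases h.join_cases_of_not_indep (fun x hx y hy => (hAB y hy x hx).symm) hF' hF
          hne h2 with h' | ⟨h3, h4⟩
        · rw [Finset.union_comm] at h'
          simp [hav h']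
        · have := add_le_add (le_best (W := W) hF' h3) (le_best (W := W) hF h4)
          rw [add_comm] at this
          simp [this]
    · rcases h.join_cases_of_not_indep hAB hF hF' hne' h1 with h' | ⟨h3, h4⟩
      · simp [hav h']
      · have := add_le_add (le_best (W := W) hF h3) (le_best (W := W) hF' h4)
        simp [this]
  · refine max_le (max_le (max_le (max_le (max_le ?_ ?_) ?_) ?_) ?_) ?_
    · exact best_le_best Finset.subset_union_left fun _ _ h => h
    · exact best_le_best Finset.subset_union_right fun _ _ h => h
    · exact best_add_best_le hd hereditary_indep.1 hereditary_indep.1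
        fun _ _ _ _ h h' => h.noShortOddCycle_union h'
    · rw [← best_avoids_union hd]
      exact best_le_best subset_rfl fun _ _ h => h.isolatesT.noShortOddCycle
    · exact best_add_best_le hd hereditary_isolatesT.1 hereditary_avoidsSingle.1
        fun _ _ _ _ h h' => h.noShortOddCycle_union h'
    · rw [Finset.union_comm]
      exact best_add_best_le hd.symm hereditary_isolatesT.1 hereditary_avoidsSingle.1
        fun _ _ _ _ h h' => h.noShortOddCycle_union h'

end Join

omit [DecidableEq V] in
theorem best_singleton {P : Finset V → Prop} {v : V} (h : P {v}) : best W P {v} = W v := by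
  classical
  refine le_antisymm (best_le fun F hF _ => ?_) ?_
  · simpa using Finset.sum_le_sum_of_subset (f := W) hF
  · simpa using le_best (W := W) (subset_refl {v}) h

omit [DecidableEq V] in
-- At most the empty set is left as a candidate; if even that fails, the supremum over no sets is 0
-- as well.
theorem best_singleton_of_not {P : Finset V → Prop} {v : V} (h : ¬ P {v}) : best W P {v} = 0 := by
  classical
  refine Nat.le_zero.1 (best_le fun F hF hP => ?_)
  rcases Finset.subset_singleton_iff.1 hF with rfl | rfl
  · simp
  · exact absurd hP h

end Recurrences

/-! ### Partitions into uniform classes and the table of maxima -/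

section Labelling

variable {n : ℕ} {G : SimpleGraph (Fin n)} {T : Finset (Fin n)} {W : Fin n → ℕ}

/-- `f` maps every vertex to the representative of its class in a partition into classes between
which the adjacency is that of the representatives. -/
structure IsLabelling (G : SimpleGraph (Fin n)) (f : Fin n → Fin n) : Prop where
  le : ∀ v, f v ≤ v
  idem : ∀ v, f (f v) = f v
  adj : ∀ x y, f x ≠ f y → (G.Adj x y ↔ G.Adj (f x) (f y))

/-- The representatives. -/
def roots (f : Fin n → Fin n) : Finset (Fin n) := Finset.univ.filter fun v => f v = v

/-- The class represented by `i`. -/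
def classOf (f : Fin n → Fin n) (i : Fin n) : Finset (Fin n) := Finset.univ.filter fun v => f v = i

/-- The labelling in which `j` no longer is a representative, its class being added to that
of `i`. -/
def mergeLabel (f : Fin n → Fin n) (i j : Fin n) (v : Fin n) : Fin n := if f v = j then i else f v

@[simp] theorem mem_roots {f : Fin n → Fin n} {v : Fin n} : v ∈ roots f ↔ f v = v := by
  simp [roots]

@[simp] theorem mem_classOf {f : Fin n → Fin n} {v i : Fin n} : v ∈ classOf f i ↔ f v = i := by
  simp [classOf]

theorem isLabelling_id : IsLabelling G id := ⟨fun _ => le_rfl, fun _ => rfl, fun _ _ _ => Iff.rfl⟩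

variable {f : Fin n → Fin n} {i j : Fin n}

theorem roots_mergeLabel (h : Twins G (roots f) i j) :
    roots (mergeLabel f i j) = (roots f).erase j := by
  obtain ⟨hi, hj, hij, -⟩ := h
  rw [mem_roots] at hi hj
  ext v
  simp only [mem_roots, mergeLabel, Finset.mem_erase]
  split_ifs with hv
  · constructor
    · rintro rfl
      exact absurd (hi.symm.trans hv) hij
    · rintro ⟨h1, h2⟩
      exact absurd (h2.symm.trans hv) h1
  · constructor
    · intro h
      exact ⟨fun h' => hv (by rw [h, h']), h⟩
    · exact fun h => h.2

theorem card_roots_mergeLabel (h : Twins G (roots f) i j) :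
    (roots (mergeLabel f i j)).card + 1 = (roots f).card := by
  rw [roots_mergeLabel h, Finset.card_erase_add_one h.2.1]

theorem classOf_mergeLabel_left : classOf (mergeLabel f i j) i = classOf f i ∪ classOf f j := by
  ext v
  simp only [mem_classOf, mergeLabel, Finset.mem_union]
  split_ifs with hv <;> simp [hv]

theorem classOf_mergeLabel_of_ne {m : Fin n} (hi : m ≠ i) (hj : m ≠ j) :
    classOf (mergeLabel f i j) m = classOf f m := by
  ext v
  simp only [mem_classOf, mergeLabel]
  split_ifs with hv
  · simp [hv, hi.symm, hj.symm]
  · rfl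

theorem disjoint_classOf (hij : i ≠ j) : Disjoint (classOf f i) (classOf f j) := by
  rw [Finset.disjoint_left]
  simp only [mem_classOf]
  rintro v rfl h
  exact hij h

/-- Vertices from the class of `j` now have to be judged by `i`; towards third classes this is
correct because `i` and `j` are twins among the representatives. The order `i < j` preserves `f v ≤
v`. -/
theorem IsLabelling.merge (hf : IsLabelling G f) (h : Twins G (roots f) i j) (hlt : i < j) :
    IsLabelling G (mergeLabel f i j) := by
  have hi : f i = i := mem_roots.1 h.1
  have hj : f j = j := mem_roots.1 h.2.1
  refine ⟨fun v => ?_, fun v => ?_, fun x y hxy => ?_⟩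
  · have := hf.le v
    simp only [mergeLabel]
    split_ifs with hv
    · rw [hv] at this
      exact hlt.le.trans this
    · exact this
  · simp only [mergeLabel]
    split_ifs with h1 h2 h2
    · rfl
    · exact hi
    · exact absurd ((hf.idem v).symm.trans h2) h1
    · exact hf.idem v
  · have hk : ∀ v, f v ≠ i → f v ≠ j → (G.Adj i (f v) ↔ G.Adj j (f v)) := fun v =>
      h.2.2.2 (f v) (mem_roots.2 (hf.idem v))
    simp only [mergeLabel] at *
    split_ifs at * with h1 h2 h2
    · exact absurd rfl hxy
    · rw [hf.adj x y (by rw [h1]; exact Ne.symm h2), h1, hk y hxy.symm h2]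
    · rw [hf.adj x y (by rw [h2]; exact h1), h2, G.adj_comm, G.adj_comm _ i, hk x hxy h1]
    · exact hf.adj x y hxy

/-- The table `τ` contains for every `i` whether `i` is a representative, and if so, the maximum
weights of the relevant kinds of subsets of its class. -/
structure IsTable (G : SimpleGraph (Fin n)) (T : Finset (Fin n)) (W : Fin n → ℕ)
    (f : Fin n → Fin n) (τ : ℕ → ℕ → ℕ) : Prop where
  alive : ∀ i : Fin n, τ 0 i = if f i = i then 1 else 0
  avoids : ∀ i : Fin n, f i = i → τ 1 i = best W (Avoids T) (classOf f i)
  indep : ∀ i : Fin n, f i = i → τ 2 i = best W (Indep G) (classOf f i)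
  isolates : ∀ i : Fin n, f i = i → τ 3 i = best W (IsolatesT G T) (classOf f i)
  good : ∀ i : Fin n, f i = i → τ 4 i = best W (NoShortOddCycle G T) (classOf f i)
  single : ∀ i : Fin n, f i = i → τ 5 i = best W (AvoidsSingle T) (classOf f i)

theorem isTable_id {τ : ℕ → ℕ → ℕ} (h0 : ∀ i : Fin n, τ 0 i = 1)
    (h1 : ∀ i : Fin n, τ 1 i = if i ∈ T then 0 else W i) (h2 : ∀ i : Fin n, τ 2 i = W i)
    (h3 : ∀ i : Fin n, τ 3 i = W i) (h4 : ∀ i : Fin n, τ 4 i = W i)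
    (h5 : ∀ i : Fin n, τ 5 i = if i ∈ T then 0 else W i) : IsTable G T W id τ := by
  have hc : ∀ i : Fin n, classOf id i = {i} := fun i => by ext; simp
  have hI : ∀ i : Fin n, IsolatesT G T {i} := fun i => by simp [IsolatesT]
  refine ⟨fun i => by simp [h0], fun i _ => ?_, fun i _ => ?_, fun i _ => ?_, fun i _ => ?_,
    fun i _ => ?_⟩
  · rw [hc, h1]
    split_ifs with h
    · rw [best_singleton_of_not (by simp [Avoids, h])]
    · rw [best_singleton (by simp [Avoids, h])]
  · rw [hc, h2, best_singleton (by simp [Indep])]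
  · rw [hc, h3, best_singleton (hI i)]
  · rw [hc, h4, best_singleton (hI i).noShortOddCycle]
  · rw [hc, h5]
    split_ifs with h
    · rw [best_singleton_of_not (by simp [Avoids, AvoidsSingle, h])]
    · rw [best_singleton (by simp [Avoids, AvoidsSingle, h])]

/-- The labelling makes the two classes completely joined or completely unjoined, according to the
adjacency of `i` and `j`, so the recurrences apply to the merged class. -/
theorem IsTable.merge {τ τ' : ℕ → ℕ → ℕ} (hτ : IsTable G T W f τ) (hf : IsLabelling G f)
    (h : Twins G (roots f) i j)
    (hm : ∀ a < 6, ∀ m : Fin n, m ≠ i → m ≠ j → τ' a m = τ a m)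
    (h0i : τ' 0 i = 1) (h0j : τ' 0 j = 0) (h1 : τ' 1 i = τ 1 i + τ 1 j)
    (h5 : τ' 5 i = max (τ 5 i) (τ 5 j))
    (hadj : G.Adj i j → τ' 2 i = max (τ 2 i) (τ 2 j) ∧
      τ' 3 i = max (max (τ 3 i) (τ 3 j)) (τ 1 i + τ 1 j) ∧
      τ' 4 i = max (max (max (max (max (τ 4 i) (τ 4 j)) (τ 2 i + τ 2 j)) (τ 1 i + τ 1 j))
        (τ 3 i + τ 5 j)) (τ 3 j + τ 5 i))
    (hnot : ¬ G.Adj i j → τ' 2 i = τ 2 i + τ 2 j ∧ τ' 3 i = τ 3 i + τ 3 j ∧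
      τ' 4 i = τ 4 i + τ 4 j) :
    IsTable G T W (mergeLabel f i j) τ' := by
  have hi : f i = i := mem_roots.1 h.1
  have hj : f j = j := mem_roots.1 h.2.1
  have hij : i ≠ j := h.2.2.1
  have hd : Disjoint (classOf f i) (classOf f j) := disjoint_classOf hij
  have hroot : ∀ m, mergeLabel f i j m = m ↔ m ≠ j ∧ f m = m := fun m => by
    rw [← mem_roots, roots_mergeLabel h, Finset.mem_erase, mem_roots]
  have hA : G.Adj i j → ∀ x ∈ classOf f i, ∀ y ∈ classOf f j, G.Adj x y := by
    intro ha x hx y hy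
    rw [mem_classOf] at hx hy
    rwa [hf.adj x y (by rwa [hx, hy]), hx, hy]
  have hN : ¬ G.Adj i j → ∀ x ∈ classOf f i, ∀ y ∈ classOf f j, ¬ G.Adj x y := by
    intro ha x hx y hy
    rw [mem_classOf] at hx hy
    rwa [hf.adj x y (by rwa [hx, hy]), hx, hy]
  refine ⟨fun m => ?_, fun m hmr => ?_, fun m hmr => ?_, fun m hmr => ?_, fun m hmr => ?_,
    fun m hmr => ?_⟩
  · rw [if_congr (hroot m) rfl rfl]
    by_cases h1 : m = i
    · subst h1
      simp [h0i, hij, hi]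
    by_cases h2 : m = j
    · subst h2
      simp [h0j]
    · rw [hm 0 (by norm_num) m h1 h2, hτ.alive]
      simp [h2]
  all_goals
    rw [hroot] at hmr
    by_cases hmi : m = i
    · subst hmi
      rw [classOf_mergeLabel_left]
      by_cases ha : G.Adj m j
      · obtain ⟨g2, g3, g4⟩ := hadj ha
        have hA := hA ha
        simp only [h1, g2, g3, g4, h5, best_avoids_union hd, best_avoidsSingle_union hd,
          best_indep_join hA hd, best_isolatesT_join hA hd, best_noShortOddCycle_join hA hd,
          hτ.avoids _ hi, hτ.avoids _ hj, hτ.indep _ hi, hτ.indep _ hj, hτ.isolates _ hi,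
          hτ.isolates _ hj, hτ.good _ hi, hτ.good _ hj, hτ.single _ hi, hτ.single _ hj]
      · obtain ⟨g2, g3, g4⟩ := hnot ha
        have hN := hN ha
        simp only [h1, g2, g3, g4, h5, best_avoids_union hd, best_avoidsSingle_union hd,
          best_indep_union hN hd, best_isolatesT_union hN hd, best_noShortOddCycle_union hN hd,
          hτ.avoids _ hi, hτ.avoids _ hj, hτ.indep _ hi, hτ.indep _ hj, hτ.isolates _ hi,
          hτ.isolates _ hj, hτ.good _ hi, hτ.good _ hj, hτ.single _ hi, hτ.single _ hj]
    · rw [hm _ (by norm_num) m hmi hmr.1, classOf_mergeLabel_of_ne hmi hmr.1]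
      first
        | exact hτ.avoids m hmr.2
        | exact hτ.indep m hmr.2
        | exact hτ.isolates m hmr.2
        | exact hτ.good m hmr.2
        | exact hτ.single m hmr.2

/-- By `f v ≤ v`, vertex 0 is always a representative. A last remaining class is therefore
represented by 0, which tells the program where to find the answer. -/
theorem IsLabelling.eq_zero (hf : IsLabelling G f) (hc : (roots f).card ≤ 1) (h0 : 0 < n)
    (v : Fin n) : f v = ⟨0, h0⟩ := by
  refine Finset.card_le_one.1 hc _ (mem_roots.2 (hf.idem v)) _ (mem_roots.2 ?_)
  exact le_antisymm (hf.le _) (Fin.mk_le_of_le_val (Nat.zero_le _))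

theorem IsTable.good_zero {τ : ℕ → ℕ → ℕ} (hτ : IsTable G T W f τ) (hf : IsLabelling G f)
    (hc : (roots f).card ≤ 1) (h0 : 0 < n) :
    τ 4 0 = best W (NoShortOddCycle G T) Finset.univ := by
  have h := hf.eq_zero hc h0
  have := hτ.good ⟨0, h0⟩ (h _)
  rwa [show classOf f ⟨0, h0⟩ = Finset.univ by ext v; simp [h]] at this

end Labelling

/-! ### Integral weights and passage to complements -/

namespace WSOCT

variable (I : WSOCT)

/-- The product of the denominators of the weights. -/
def denProd : ℕ := ∏ v, (I.w v).den

/-- The weights, multiplied by the product of their denominators. -/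
def scaled (v : Fin I.n) : ℕ := I.denProd / (I.w v).den * (I.w v).num

theorem scaled_eq (v : Fin I.n) : (I.scaled v : ℚ≥0) = I.denProd * I.w v := by
  obtain ⟨c, hc⟩ : (I.w v).den ∣ I.denProd := Finset.dvd_prod_of_mem (fun v => (I.w v).den) (Finset.mem_univ v)
  have hden : ((I.w v).den : ℚ≥0) ≠ 0 := by exact_mod_cast (I.w v).den_ne_zero
  rw [scaled, hc, Nat.mul_div_cancel_left _ (I.w v).den_pos]
  have hw : ((I.w v).den : ℚ≥0) * I.w v = (I.w v).num := by
    nth_rewrite 2 [← NNRat.num_div_den (I.w v)]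
    field_simp
  push_cast
  rw [← hw]
  ring

theorem denProd_pos : 0 < I.denProd := Finset.prod_pos fun v _ => (I.w v).den_pos

theorem sum_le_iff (S : Finset (Fin I.n)) :
    ∑ v ∈ S, I.w v ≤ (I.k : ℚ≥0) ↔ ∑ v ∈ S, I.scaled v ≤ I.denProd * I.k := by
  have h : (0 : ℚ≥0) < I.denProd := by exact_mod_cast I.denProd_pos
  rw [← Nat.cast_le (α := ℚ≥0)]
  push_cast
  simp only [scaled_eq, ← Finset.mul_sum]
  exact (mul_le_mul_iff_right₀ h).symm

/-- The sets `S` and `F` are complements of each other. Writing the budget as a summand avoids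
subtraction in the natural numbers. -/
theorem isYes_iff (hI : IsFree (SimpleGraph.pathGraph 4) I.G) :
    I.IsYes ↔ ∑ v, I.scaled v ≤
      I.denProd * I.k + best I.scaled (NoShortOddCycle I.G I.T) Finset.univ := by
  constructor
  · rintro ⟨S, hS, hw⟩
    rw [sum_le_iff] at hw
    have := le_best (W := I.scaled) (Finset.subset_univ Sᶜ)
      (hS.noShortOddCycle (F := Sᶜ) (by simp))
    rw [← Finset.sum_add_sum_compl S]
    exact add_le_add hw this
  · intro h
    obtain ⟨F, -, hF, hw⟩ := exists_best (W := I.scaled) (X := Finset.univ)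
      (hereditary_noShortOddCycle (G := I.G) (T := I.T)).1
    refine ⟨Fᶜ, hI.noInducedP4.isOddCycleTransversal hF, ?_⟩
    rw [sum_le_iff]
    rw [← hw, ← Finset.sum_add_sum_compl F] at h
    omega

end WSOCT

/-! ### The input in memory -/

namespace WSOCT

open RAM

theorem length_encode (I : WSOCT) : I.encode.length = 2 + 3 * I.n + I.n * I.n := by
  simp only [encode, List.length_append, List.length_ofFn, List.length_cons, List.length_nil]
  ring

/-- The state `s` holds the instance `I` in the first memory cells, its order in register `1` and
the first free address in register `0`. -/
structure Loaded (I : WSOCT) (s : State) : Prop where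
  base : s.reg 0 = 2 + 3 * I.n + I.n * I.n
  order : s.reg 1 = I.n
  bound : s.mem 1 = I.k
  mem_T : ∀ v : Fin I.n, s.mem (2 + v) = if v ∈ I.T then 1 else 0
  num : ∀ v : Fin I.n, s.mem (2 + I.n + v) = (I.w v).num
  den : ∀ v : Fin I.n, s.mem (2 + I.n + I.n + v) = (I.w v).den
  adj_one : ∀ u v : Fin I.n, I.G.Adj u v → s.mem (2 + I.n * 3 + u * I.n + v) = 1
  adj_zero : ∀ u v : Fin I.n, ¬ I.G.Adj u v → s.mem (2 + I.n * 3 + u * I.n + v) = 0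

theorem loaded_init (I : WSOCT) : I.Loaded ((init I.encode).set 1 I.n) := by
  classical
  have hadj : ∀ u v : Fin I.n, (init I.encode).mem (2 + I.n * 3 + u * I.n + v) =
      if I.G.Adj u v then 1 else 0 := by
    intro u v
    have hlt : (u : ℕ) * I.n + v < I.n * I.n := by nlinarith [u.2, v.2]
    have h0 : 0 < I.n := u.pos
    simp only [init, encode, List.getD_eq_getElem?_getD]
    rw [List.getElem?_append_right (by simp; omega), List.getElem?_ofFn]
    simp only [List.length_append, List.length_ofFn, List.length_cons, List.length_nil]
    simp only [show 2 + I.n * 3 + (u : ℕ) * I.n + v - (0 + 1 + 1 + I.n + I.n + I.n) = u * I.n + v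
      by omega]
    rw [dif_pos hlt]
    have h1 : Fin.divNat (⟨u * I.n + v, hlt⟩ : Fin (I.n * I.n)) = u := by
      ext
      simp only [Fin.coe_divNat]
      rw [mul_comm, Nat.mul_add_div h0, Nat.div_eq_of_lt v.2, add_zero]
    have h2 : Fin.modNat (⟨u * I.n + v, hlt⟩ : Fin (I.n * I.n)) = v := by
      ext
      simp only [Fin.coe_modNat]
      rw [mul_comm, Nat.mul_add_mod, Nat.mod_eq_of_lt v.2]
    rw [h1, h2]
    simp
  refine ⟨by simp [init, length_encode], by simp, ?_, fun v => ?_, fun v => ?_, fun v => ?_,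
    fun u v h => by simp [hadj, h], fun u v h => by simp [hadj, h]⟩
  · simp [init, encode]
  · simp only [State.set_mem, init, encode, List.getD_eq_getElem?_getD, List.append_assoc]
    rw [List.getElem?_append_right (by simp), List.getElem?_append_left (by simp)]
    simp
  · simp only [State.set_mem, init, encode, List.getD_eq_getElem?_getD, List.append_assoc]
    rw [List.getElem?_append_right (by simp; omega), List.getElem?_append_right (by simp; omega),
      List.getElem?_append_left (by simp; omega)]
    simp [show 2 + I.n + (v : ℕ) - 2 - I.n = v by omega]
  · simp only [State.set_mem, init, encode, List.getD_eq_getElem?_getD, List.append_assoc]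
    rw [List.getElem?_append_right (by simp; omega), List.getElem?_append_right (by simp; omega),
      List.getElem?_append_right (by simp; omega), List.getElem?_append_left (by simp; omega)]
    simp [show 2 + I.n + I.n + (v : ℕ) - 2 - I.n - I.n = v by omega]

theorem Loaded.congr {I : WSOCT} {s s' : State} (h : I.Loaded s) (h0 : s'.reg 0 = s.reg 0)
    (h1 : s'.reg 1 = s.reg 1) (hm : ∀ i < s.reg 0, s'.mem i = s.mem i) : I.Loaded s' := by
  have hb := h.base
  have hn : ∀ u v : Fin I.n, 2 + I.n * 3 + u * I.n + v < s.reg 0 := fun u v => by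
    rw [hb]
    nlinarith [u.2, v.2]
  have hsq : 0 ≤ I.n * I.n := Nat.zero_le _
  refine ⟨h0.trans hb, h1.trans h.order, ?_, fun v => ?_, fun v => ?_, fun v => ?_,
    fun u v huv => ?_, fun u v huv => ?_⟩
  · rw [hm _ (by omega), h.bound]
  · rw [hm _ (by omega), h.mem_T]
  · rw [hm _ (by omega), h.num]
  · rw [hm _ (by omega), h.den]
  · rw [hm _ (hn u v), h.adj_one u v huv]
  · rw [hm _ (hn u v), h.adj_zero u v huv]

theorem Loaded.set {I : WSOCT} {s : State} (h : I.Loaded s) {x : ℕ} (h0 : x ≠ 0) (h1 : x ≠ 1)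
    (v : ℕ) : I.Loaded (s.set x v) :=
  h.congr (by simp [h0.symm]) (by simp [h1.symm]) fun _ _ => rfl

end WSOCT

/-! ### Table access and derived expressions -/

namespace RAM

/-- Row `a < 8` and column `i` of the table starting at the address in register `0`. -/
def State.cell (s : State) (a i : ℕ) : ℕ := s.mem (s.reg 0 + i * 8 + a)

/-- The state after writing `v` to row `a` and column `i` of the table. -/
def State.putCell (s : State) (a i v : ℕ) : State := s.put (s.reg 0 + i * 8 + a) v

@[simp] theorem State.putCell_reg (s : State) (a i v : ℕ) : (s.putCell a i v).reg = s.reg := rfl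

theorem State.cell_putCell (s : State) {a b : ℕ} (i j v : ℕ) (ha : a < 8) (hb : b < 8) :
    (s.putCell a i v).cell b j = if b = a ∧ j = i then v else s.cell b j := by
  simp only [State.cell, State.putCell, State.put_mem, State.put_reg]
  congr 1
  simp only [eq_iff_iff]
  omega

theorem State.cell_set (s : State) {x : ℕ} (v a i : ℕ) (hx : x ≠ 0) :
    (s.set x v).cell a i = s.cell a i := by
  simp [State.cell, hx.symm]

theorem _root_.WSOCT.Loaded.putCell {I : WSOCT} {s : State} (h : I.Loaded s) (a i v : ℕ) :
    I.Loaded (s.putCell a i v) := by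
  refine h.congr rfl rfl fun j hj => ?_
  rw [State.putCell, State.put_mem, if_neg (by omega)]

/-- The address of row `a` and column `i` of the table. -/
def Expr.addr (a : ℕ) (i : Expr) : Expr :=
  .bin .add (.bin .add (.reg 0) (.bin .mul i (.const 8))) (.const a)

/-- The contents of row `a` of the table, in the column with its number in register `x`. -/
def Expr.cell (a x : ℕ) : Expr := .load (.addr a (.reg x))

@[simp] theorem Expr.eval_cell (s : State) (a x : ℕ) :
    (Expr.cell a x).eval s = s.cell a (s.reg x) := rfl

@[simp] theorem Expr.weight_addr (s : State) (a : ℕ) (i : Expr) :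
    (Expr.addr a i).weight s = i.weight s + a + 18 := by
  have : Nat.size 8 = 4 := by decide
  simp only [Expr.addr, Expr.weight, Expr.eval, Op.extra, this]
  omega

@[simp] theorem Expr.weight_cell (s : State) (a x : ℕ) : (Expr.cell a x).weight s = a + 20 := by
  simp only [Expr.cell, Expr.weight, Expr.weight_addr]
  omega

theorem Wp.storeCell {a x : ℕ} {e : Expr} {u : ℕ} {Q : State → Prop} {s : State}
    (hu : a + e.weight s + 20 ≤ u) (h : Q (s.putCell a (s.reg x) (e.eval s))) :
    Wp (.store (.addr a (.reg x)) e) u Q s :=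
  Wp.store (by simp only [Expr.weight_addr, Expr.weight]; omega) h

/-- The maximum of two expressions. -/
def Expr.max (a b : Expr) : Expr := .bin .add b (.bin .sub a b)

@[simp] theorem Expr.eval_max (s : State) (a b : Expr) :
    (Expr.max a b).eval s = Max.max (a.eval s) (b.eval s) := by
  simp only [Expr.max, Expr.eval, Op.eval]
  omega

@[simp] theorem Expr.weight_max (s : State) (a b : Expr) :
    (Expr.max a b).weight s = a.weight s + 2 * b.weight s + 2 := by
  simp only [Expr.max, Expr.weight, Op.extra]
  omega

/-- The sum of two expressions. -/
def Expr.add (a b : Expr) : Expr := .bin .add a b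

@[simp] theorem Expr.eval_add (s : State) (a b : Expr) :
    (Expr.add a b).eval s = a.eval s + b.eval s := rfl

@[simp] theorem Expr.weight_add (s : State) (a b : Expr) :
    (Expr.add a b).weight s = a.weight s + b.weight s + 1 := rfl

/-- The test `a = b`. -/
def Expr.eq (a b : Expr) : Expr := .bin .eq a b

@[simp] theorem Expr.eval_eq (s : State) (a b : Expr) :
    (Expr.eq a b).eval s = if a.eval s = b.eval s then 1 else 0 := rfl

@[simp] theorem Expr.weight_eq (s : State) (a b : Expr) :
    (Expr.eq a b).weight s = a.weight s + b.weight s + 1 := rfl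

/-- The test `a < b`. -/
def Expr.lt (a b : Expr) : Expr := .bin .lt a b

@[simp] theorem Expr.eval_lt (s : State) (a b : Expr) :
    (Expr.lt a b).eval s = if a.eval s < b.eval s then 1 else 0 := rfl

@[simp] theorem Expr.weight_lt (s : State) (a b : Expr) :
    (Expr.lt a b).weight s = a.weight s + b.weight s + 1 := rfl

end RAM

/-! ### Programs for recognising twins and merging classes -/

namespace WSOCT

open RAM

/-- The entry of the adjacency matrix for the vertices in the registers `x` and `y`. -/
def adjExpr (x y : ℕ) : Expr :=
  .load (.add (.add (.add (.const 2) (.bin .mul (.reg 1) (.const 3))) (.bin .mul (.reg x) (.reg 1)))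
    (.reg y))

variable {I : WSOCT} {s : State}

open Classical in
theorem Loaded.eval_adjExpr (h : I.Loaded s) {x y : ℕ} {u v : Fin I.n} (hx : s.reg x = u)
    (hy : s.reg y = v) : (adjExpr x y).eval s = if I.G.Adj u v then 1 else 0 := by
  simp only [adjExpr, Expr.eval, Expr.eval_add, Op.eval, hx, hy, h.order]
  split_ifs with hadj
  exacts [h.adj_one u v hadj, h.adj_zero u v hadj]

theorem Loaded.weight_adjExpr_le (h : I.Loaded s) (x y : ℕ) :
    (adjExpr x y).weight s ≤ 30 + I.n := by
  have h3 : Nat.size 3 = 2 := by decide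
  have := size_le_self I.n
  simp only [adjExpr, Expr.weight, Expr.weight_add, Expr.eval, Op.extra, h.order, h3]
  omega

/-- A conjunction of four tests is computed by asking whether their sum exceeds 3, and a negation by
comparing with 0. -/
theorem four_tests_eq_zero_iff {a b c p q : Prop} [Decidable a] [Decidable b] [Decidable c]
    [Decidable p] [Decidable q] :
    (if 3 < (if a then 1 else 0) + (if (if b then 1 else 0) = 0 then 1 else 0) +
      (if (if c then 1 else 0) = 0 then 1 else 0) +
      (if (if (if p then 1 else 0) = (if q then 1 else 0) then 1 else 0) = 0 then 1 else 0)
      then 1 else 0) = 0 ↔ (a → ¬ b → ¬ c → (p ↔ q)) := by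
  by_cases a <;> by_cases b <;> by_cases c <;> by_cases p <;> by_cases q <;> simp [*]

/-- Counts in register `10` the representatives `k` that distinguish the vertices `i` and `j` in
the registers `8` and `9`. -/
def searchBody : Prog :=
  .assign 10 (.add (.reg 10) (.lt (.const 3) (.add (.add (.add (.cell 0 7)
    (.eq (.eq (.reg 7) (.reg 8)) (.const 0))) (.eq (.eq (.reg 7) (.reg 9)) (.const 0)))
    (.eq (.eq (adjExpr 8 7) (adjExpr 9 7)) (.const 0)))))

/-- The counter in register 10 is only compared with 0: it stays 0 as long as no representative seen
so far distinguishes `i` from `j`. The term `2 * I.n` in the weight comes from the two lookups in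
the adjacency matrix. -/
theorem wp_search (h : I.Loaded s) {f : Fin I.n → Fin I.n}
    (hf : ∀ v : Fin I.n, s.cell 0 v = if f v = v then 1 else 0) {i j : Fin I.n}
    (hi : s.reg 8 = i) (hj : s.reg 9 = j) (h10 : s.reg 10 = 0) :
    Wp (.forLoop 7 1 searchBody) (I.n * (150 + 2 * I.n + 9) + 6)
      (fun s' => s'.mem = s.mem ∧ (∀ x, x ≠ 7 → x ≠ 10 → s'.reg x = s.reg x) ∧
        (s'.reg 10 = 0 ↔ ∀ k ∈ roots f, k ≠ i → k ≠ j → (I.G.Adj i k ↔ I.G.Adj j k))) s := by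
  classical
  have hloop := Wp.forLoop (x := 7) (y := 1) (p := searchBody) (u := 150 + 2 * I.n) (s := s)
    (fun c s' => s'.mem = s.mem ∧ (∀ x, x ≠ 7 → x ≠ 10 → s'.reg x = s.reg x) ∧
      (s'.reg 10 = 0 ↔ ∀ k ∈ roots f, k.val < c → k ≠ i → k ≠ j → (I.G.Adj i k ↔ I.G.Adj j k)))
    I.n (by norm_num) h.order ?_ ?_
  · refine hloop.imp le_rfl ?_
    rintro s' ⟨h1, h2, h3⟩
    refine ⟨h1, h2, h3.trans ?_⟩
    simp
  · refine ⟨rfl, ?_, ?_⟩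
    · intro x hx _
      simp [hx]
    · simp [h10]
  · rintro c hc t ⟨hm, hr, hb⟩ ht7 ht1
    have hL : I.Loaded t := h.congr (hr 0 (by norm_num) (by norm_num))
      (hr 1 (by norm_num) (by norm_num)) (by simp [hm])
    have ht8 : t.reg 8 = i := (hr 8 (by norm_num) (by norm_num)).trans hi
    have ht9 : t.reg 9 = j := (hr 9 (by norm_num) (by norm_num)).trans hj
    have hcell : t.cell 0 c = if f ⟨c, hc⟩ = ⟨c, hc⟩ then 1 else 0 := by
      rw [← hf ⟨c, hc⟩, State.cell, State.cell, hm, hr 0 (by norm_num) (by norm_num)]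
    refine Wp.assign ?_ ?_
    · have h1 := hL.weight_adjExpr_le 8 7
      have h2 := hL.weight_adjExpr_le 9 7
      simp only [Expr.weight_add, Expr.weight_lt, Expr.weight_eq, Expr.weight_cell, Expr.weight]
      omega
    · have e1 := hL.eval_adjExpr (x := 8) (y := 7) (u := i) (v := ⟨c, hc⟩) ht8 ht7
      have e2 := hL.eval_adjExpr (x := 9) (y := 7) (u := j) (v := ⟨c, hc⟩) ht9 ht7
      refine ⟨by simp [ht7], by simp [ht1], by simp [hm], ?_, ?_⟩
      · intro x hx hx'
        simp [hx, hx', hr]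
      · simp only [State.set_reg, Expr.eval_add, Expr.eval_lt, Expr.eval_eq, Expr.eval_cell,
          Expr.eval, e1, e2, ht7, ht8, ht9, hcell]
        rw [if_neg (by norm_num), if_pos trivial, Nat.add_eq_zero_iff, hb]
        have hstep : (∀ k ∈ roots f, k.val < c + 1 → k ≠ i → k ≠ j → (I.G.Adj i k ↔ I.G.Adj j k)) ↔
            (∀ k ∈ roots f, k.val < c → k ≠ i → k ≠ j → (I.G.Adj i k ↔ I.G.Adj j k)) ∧
            (f ⟨c, hc⟩ = ⟨c, hc⟩ → c ≠ i.val → c ≠ j.val →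
              (I.G.Adj i ⟨c, hc⟩ ↔ I.G.Adj j ⟨c, hc⟩)) := by
          constructor
          · intro H
            refine ⟨fun k hk hkc => H k hk (by omega), fun h1 h2 h3 => H _ (mem_roots.2 h1)
              (Nat.lt_succ_self c) (fun h' => h2 (by rw [← h'])) (fun h' => h3 (by rw [← h']))⟩
          · rintro ⟨H1, H2⟩ k hk hkc h2 h3
            rcases Nat.lt_succ_iff_lt_or_eq.1 hkc with hkc | hkc
            · exact H1 k hk hkc h2 h3
            · subst hkc
              exact H2 (mem_roots.1 hk) (fun h' => h2 (Fin.ext h')) (fun h' => h3 (Fin.ext h'))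
        rw [hstep]
        refine and_congr Iff.rfl ?_
        exact four_tests_eq_zero_iff

/-- The new entries for a class all of whose vertices are joined to those of the other class. -/
def joinEntries : Prog :=
  .seq (.store (.addr 4 (.reg 8)) (.max (.max (.max (.max (.max (.cell 4 8) (.cell 4 9))
    (.add (.cell 2 8) (.cell 2 9))) (.add (.cell 1 8) (.cell 1 9)))
    (.add (.cell 3 8) (.cell 5 9))) (.add (.cell 3 9) (.cell 5 8))))
  (.seq (.store (.addr 3 (.reg 8)) (.max (.max (.cell 3 8) (.cell 3 9))
    (.add (.cell 1 8) (.cell 1 9))))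
  (.store (.addr 2 (.reg 8)) (.max (.cell 2 8) (.cell 2 9))))

/-- The new entries for a class none of whose vertices is joined to one of the other class. -/
def unionEntries : Prog :=
  .seq (.store (.addr 4 (.reg 8)) (.add (.cell 4 8) (.cell 4 9)))
  (.seq (.store (.addr 3 (.reg 8)) (.add (.cell 3 8) (.cell 3 9)))
  (.store (.addr 2 (.reg 8)) (.add (.cell 2 8) (.cell 2 9))))

/-- Rows are overwritten in the order 4, 3, 2, so that every right-hand side still reads old
entries. Rows 1 and 5, needed here, are left for `mergeProg` to update afterwards. -/
theorem wp_joinEntries (h : I.Loaded s) {i j : ℕ} (hi : s.reg 8 = i) (hj : s.reg 9 = j)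
    (hne : j ≠ i) :
    Wp joinEntries (1500 + (500 + 500)) (fun t => I.Loaded t ∧ t.reg = s.reg ∧
      (∀ a < 6, ∀ m : ℕ, m ≠ i ∨ a < 2 ∨ a = 5 → t.cell a m = s.cell a m) ∧
      t.cell 2 i = max (s.cell 2 i) (s.cell 2 j) ∧
      t.cell 3 i = max (max (s.cell 3 i) (s.cell 3 j)) (s.cell 1 i + s.cell 1 j) ∧
      t.cell 4 i = max (max (max (max (max (s.cell 4 i) (s.cell 4 j)) (s.cell 2 i + s.cell 2 j))
        (s.cell 1 i + s.cell 1 j)) (s.cell 3 i + s.cell 5 j)) (s.cell 3 j + s.cell 5 i)) s := by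
  refine Wp.seq (Wp.storeCell (by simp) ?_)
  simp only [Expr.eval_max, Expr.eval_add, Expr.eval_cell, hi, hj]
  refine Wp.seq (Wp.storeCell (by simp) ?_)
  simp only [Expr.eval_max, Expr.eval_add, Expr.eval_cell, State.putCell_reg, hi, hj]
  refine Wp.storeCell (by simp) ?_
  simp only [Expr.eval_max, Expr.eval_cell, State.putCell_reg, hi, hj]
  refine ⟨((h.putCell ..).putCell ..).putCell .., trivial, fun a ha m hm => ?_, ?_⟩
  · rw [State.cell_putCell _ _ _ _ (by norm_num) (by omega), if_neg (by omega),
      State.cell_putCell _ _ _ _ (by norm_num) (by omega), if_neg (by omega),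
      State.cell_putCell _ _ _ _ (by norm_num) (by omega), if_neg (by omega)]
  · simp only [State.cell_putCell, Nat.reduceLT, Nat.reduceEqDiff, and_true, and_false, if_true,
      if_false, hne]

theorem wp_unionEntries (h : I.Loaded s) {i j : ℕ} (hi : s.reg 8 = i) (hj : s.reg 9 = j)
    (hne : j ≠ i) :
    Wp unionEntries (1500 + (500 + 500)) (fun t => I.Loaded t ∧ t.reg = s.reg ∧
      (∀ a < 6, ∀ m : ℕ, m ≠ i ∨ a < 2 ∨ a = 5 → t.cell a m = s.cell a m) ∧
      t.cell 2 i = s.cell 2 i + s.cell 2 j ∧ t.cell 3 i = s.cell 3 i + s.cell 3 j ∧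
      t.cell 4 i = s.cell 4 i + s.cell 4 j) s := by
  refine Wp.seq (Wp.storeCell (by simp) ?_)
  simp only [Expr.eval_add, Expr.eval_cell, hi, hj]
  refine Wp.seq (Wp.storeCell (by simp) ?_)
  simp only [Expr.eval_add, Expr.eval_cell, State.putCell_reg, hi, hj]
  refine Wp.storeCell (by simp) ?_
  simp only [Expr.eval_add, Expr.eval_cell, State.putCell_reg, hi, hj]
  refine ⟨((h.putCell ..).putCell ..).putCell .., trivial, fun a ha m hm => ?_, ?_⟩
  · rw [State.cell_putCell _ _ _ _ (by norm_num) (by omega), if_neg (by omega),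
      State.cell_putCell _ _ _ _ (by norm_num) (by omega), if_neg (by omega),
      State.cell_putCell _ _ _ _ (by norm_num) (by omega), if_neg (by omega)]
  · simp only [State.cell_putCell, Nat.reduceLT, Nat.reduceEqDiff, and_true, and_false, if_true,
      if_false, hne]

/-- Merges the class of the vertex in register `9` into that of the vertex in register `8`. -/
def mergeProg : Prog :=
  .seq (.cond (adjExpr 8 9) joinEntries unionEntries)
  (.seq (.store (.addr 1 (.reg 8)) (.add (.cell 1 8) (.cell 1 9)))
  (.seq (.store (.addr 5 (.reg 8)) (.max (.cell 5 8) (.cell 5 9)))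
  (.store (.addr 0 (.reg 9)) (.const 0))))

theorem wp_mergeProg (h : I.Loaded s) {W : Fin I.n → ℕ} {f : Fin I.n → Fin I.n}
    (hf : IsLabelling I.G f) (hτ : IsTable I.G I.T W f s.cell) {i j : Fin I.n}
    (hi : s.reg 8 = i) (hj : s.reg 9 = j) (hT : Twins I.G (roots f) i j) :
    Wp mergeProg (4000 + I.n) (fun s' => I.Loaded s' ∧ s'.reg = s.reg ∧
      IsTable I.G I.T W (mergeLabel f i j) s'.cell) s := by
  classical
  have hadj := h.weight_adjExpr_le 8 9
  have hev := h.eval_adjExpr hi hj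
  have hne : (j : ℕ) ≠ i := fun h' => hT.2.2.1 (Fin.ext h'.symm)
  have hne' : (i : ℕ) ≠ j := hne.symm
  have h0 : s.cell 0 i = 1 := by rw [hτ.alive, if_pos (mem_roots.1 hT.1)]
  -- The common tail of both branches, starting from what either branch guarantees about rows 2 to
  -- 4.
  have key : ∀ t : State, I.Loaded t → t.reg = s.reg →
      (∀ a < 6, ∀ m : ℕ, m ≠ i ∨ a < 2 ∨ a = 5 → t.cell a m = s.cell a m) →
      (I.G.Adj i j → t.cell 2 i = max (s.cell 2 i) (s.cell 2 j) ∧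
        t.cell 3 i = max (max (s.cell 3 i) (s.cell 3 j)) (s.cell 1 i + s.cell 1 j) ∧
        t.cell 4 i = max (max (max (max (max (s.cell 4 i) (s.cell 4 j)) (s.cell 2 i + s.cell 2 j))
          (s.cell 1 i + s.cell 1 j)) (s.cell 3 i + s.cell 5 j)) (s.cell 3 j + s.cell 5 i)) →
      (¬ I.G.Adj i j → t.cell 2 i = s.cell 2 i + s.cell 2 j ∧
        t.cell 3 i = s.cell 3 i + s.cell 3 j ∧ t.cell 4 i = s.cell 4 i + s.cell 4 j) →
      Wp (.seq (.store (.addr 1 (.reg 8)) (.add (.cell 1 8) (.cell 1 9)))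
        (.seq (.store (.addr 5 (.reg 8)) (.max (.cell 5 8) (.cell 5 9)))
        (.store (.addr 0 (.reg 9)) (.const 0)))) (100 + (200 + 100)) (fun s' => I.Loaded s' ∧
          s'.reg = s.reg ∧ IsTable I.G I.T W (mergeLabel f i j) s'.cell) t := by
    intro t ht hreg hcell hA hN
    refine Wp.seq (Wp.storeCell (by simp) (Wp.seq (Wp.storeCell (by simp)
      (Wp.storeCell (by simp [Expr.weight]) ⟨((ht.putCell ..).putCell ..).putCell .., by simp [hreg],
        hτ.merge hf hT ?_ ?_ ?_ ?_ ?_ ?_ ?_⟩))))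
    · intro a ha m hmi hmj
      have hmi' : (m : ℕ) ≠ i := fun h' => hmi (Fin.ext h')
      have hmj' : (m : ℕ) ≠ j := fun h' => hmj (Fin.ext h')
      simp [State.cell_putCell, show a < 8 by omega, hreg, hi, hj, hmi', hmj', hcell a ha]
    all_goals simp [State.cell_putCell, hreg, hi, hj, hne, hne', hcell, h0, Expr.eval]
    · simpa only [max_assoc] using hA
    · exact hN
  refine (Wp.seq (u := 100 + I.n + (1500 + (500 + 500))) (v := 100 + (200 + 100))
    (Wp.cond (by omega) (fun hc => ?_) (fun hc => ?_))).imp (by omega) fun _ h => h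
  · have hA : I.G.Adj i j := by
      by_contra hA
      simp [hev, hA] at hc
    refine (wp_joinEntries h hi hj hne).imp le_rfl ?_
    rintro t ⟨h1, h2, h3, h4⟩
    exact key t h1 h2 h3 (fun _ => h4) fun hN => absurd hA hN
  · have hA : ¬ I.G.Adj i j := by
      intro hA
      simp [hev, hA] at hc
    refine (wp_unionEntries h hi hj hne).imp le_rfl ?_
    rintro t ⟨h1, h2, h3, h4⟩
    exact key t h1 h2 h3 (fun hN => absurd hN hA) fun _ => h4

end WSOCT

/-! ### Rounds of merging, initialisation and the decision -/

namespace WSOCT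

open RAM

variable {I : WSOCT} {s : State}

theorem four_tests_ne_zero_iff {a b c d : Prop} [Decidable a] [Decidable b] [Decidable c]
    [Decidable d] :
    (if 3 < (if a then 1 else 0) + (if b then 1 else 0) + (if c then 1 else 0) +
      (if d then 1 else 0) then 1 else 0) ≠ 0 ↔ a ∧ b ∧ c ∧ d := by
  by_cases a <;> by_cases b <;> by_cases c <;> by_cases d <;> simp [*]

/-- Merges the classes of the vertices `i < j` for the pair number `i * n + j` in register `6`,
provided that they are representatives that no other representative distinguishes. -/
def pairProg : Prog :=
  .seq (.assign 8 (.bin .div (.reg 6) (.reg 1)))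
  (.seq (.assign 9 (.bin .sub (.reg 6) (.bin .mul (.reg 8) (.reg 1))))
  (.seq (.assign 10 (.const 0))
  (.seq (.forLoop 7 1 searchBody)
  (.cond (.lt (.const 3) (.add (.add (.add (.eq (.reg 10) (.const 0)) (.lt (.reg 8) (.reg 9)))
    (.cell 0 8)) (.cell 0 9))) mergeProg .skip))))

/-- A bound for the weight of `pairProg` on graphs with `n` vertices. -/
def pairWeight (n : ℕ) : ℕ :=
  20 + ((20 + n) + (20 + ((n * (150 + 2 * n + 9) + 6) + (100 + (4000 + n)))))

theorem wp_pairProg (h : I.Loaded s) {W : Fin I.n → ℕ} {f : Fin I.n → Fin I.n}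
    (hf : IsLabelling I.G f) (hτ : IsTable I.G I.T W f s.cell) {c : ℕ} (hc : c < I.n * I.n)
    (h6 : s.reg 6 = c) :
    Wp pairProg (pairWeight I.n) (fun s' => I.Loaded s' ∧ (∀ x < 7, s'.reg x = s.reg x) ∧
      ∃ f', IsLabelling I.G f' ∧ IsTable I.G I.T W f' s'.cell ∧
        ((f' = f ∧ ∀ i j : Fin I.n, i * I.n + j = c → i < j → ¬ Twins I.G (roots f) i j) ∨
          (roots f').card + 1 = (roots f).card)) s := by
  have hn : 0 < I.n := Nat.pos_of_ne_zero fun h0 => by simp [h0] at hc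
  have hsn := size_le_self I.n
  have h1 := h.order
  obtain ⟨i, hi⟩ : ∃ i : Fin I.n, (i : ℕ) = c / I.n := ⟨⟨_, Nat.div_lt_of_lt_mul hc⟩, rfl⟩
  -- The machine has no remainder operation, so `c % n` is computed as `c - c / n * n`.
  obtain ⟨j, hj⟩ : ∃ j : Fin I.n, (j : ℕ) = c - c / I.n * I.n := by
    refine ⟨⟨c % I.n, Nat.mod_lt _ hn⟩, ?_⟩
    have := Nat.div_add_mod' c I.n
    simp only
    omega
  have hij : ∀ i' j' : Fin I.n, i' * I.n + j' = c → i' = i ∧ j' = j := by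
    rintro i' j' rfl
    have : ((i' : ℕ) * I.n + j') / I.n = i' := by
      rw [mul_comm, Nat.mul_add_div hn, Nat.div_eq_of_lt j'.2, add_zero]
    rw [this] at hi hj
    exact ⟨Fin.ext hi.symm, Fin.ext (by omega)⟩
  refine Wp.seq (Wp.assign (by simp [Expr.weight, Op.extra]) ?_)
  simp only [Expr.eval, Op.eval, h6, h1, ← hi]
  refine Wp.seq (Wp.assign (by simp [Expr.weight, Expr.eval, Op.extra, h1]; omega) ?_)
  simp only [Expr.eval, Op.eval, State.set_reg]
  norm_num only [if_true, if_false, h6, h1]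
  rw [hi, ← hj, ← hi]
  refine Wp.seq (Wp.assign (by simp [Expr.weight]) ?_)
  simp only [Expr.eval]
  have hL := ((h.set (x := 8) (by norm_num) (by norm_num) i).set (x := 9) (by norm_num)
    (by norm_num) j).set (x := 10) (by norm_num) (by norm_num) 0
  have hcell : (((s.set 8 i).set 9 j).set 10 0).cell = s.cell := by
    ext a m
    simp only [State.cell_set, ne_eq, OfNat.ofNat_ne_zero, not_false_eq_true]
  have hreg : ∀ x < 7, (((s.set 8 i).set 9 j).set 10 0).reg x = s.reg x := by
    intro x hx
    simp [show x ≠ 8 by omega, show x ≠ 9 by omega, show x ≠ 10 by omega]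
  have hr8 : (((s.set 8 i).set 9 j).set 10 0).reg 8 = i := by simp
  have hr9 : (((s.set 8 i).set 9 j).set 10 0).reg 9 = j := by simp
  have hr10 : (((s.set 8 i).set 9 j).set 10 0).reg 10 = 0 := by simp
  generalize ((s.set 8 i).set 9 j).set 10 0 = t at *
  rw [← hcell] at hτ
  refine Wp.seq ((wp_search hL hτ.alive hr8 hr9 hr10).imp le_rfl ?_)
  rintro t' ⟨hm, hr, hs⟩
  have hL' : I.Loaded t' := hL.congr (hr 0 (by norm_num) (by norm_num))
    (hr 1 (by norm_num) (by norm_num)) (by simp [hm])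
  have hcell' : t'.cell = t.cell := by
    ext a m
    rw [State.cell, State.cell, hm, hr 0 (by norm_num) (by norm_num)]
  have hr8' : t'.reg 8 = i := (hr 8 (by norm_num) (by norm_num)).trans hr8
  have hr9' : t'.reg 9 = j := (hr 9 (by norm_num) (by norm_num)).trans hr9
  have hreg' : ∀ x < 7, t'.reg x = s.reg x := fun x hx => by
    rw [hr x (by omega) (by omega), hreg x hx]
  rw [← hcell'] at hτ
  have htest : Expr.eval t' (.lt (.const 3) (.add (.add (.add (.eq (.reg 10) (.const 0))
      (.lt (.reg 8) (.reg 9))) (.cell 0 8)) (.cell 0 9))) ≠ 0 ↔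
      i < j ∧ Twins I.G (roots f) i j := by
    simp only [Expr.eval_lt, Expr.eval_add, Expr.eval_eq, Expr.eval_cell, Expr.eval, hr8', hr9',
      hτ.alive, Fin.val_fin_lt]
    refine four_tests_ne_zero_iff.trans ?_
    rw [hs]
    exact ⟨fun ⟨g1, g2, g3, g4⟩ => ⟨g2, mem_roots.2 g3, mem_roots.2 g4, g2.ne, g1⟩,
      fun ⟨g2, g3, g4, _, g1⟩ => ⟨g1, g2, mem_roots.1 g3, mem_roots.1 g4⟩⟩
  refine Wp.cond (by simp [Expr.weight]) (fun ht => ?_) (fun ht => ?_)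
  · obtain ⟨hlt, hT⟩ := htest.1 ht
    refine (wp_mergeProg hL' hf hτ hr8' hr9' hT).imp le_rfl ?_
    rintro s' ⟨g1, g2, g3⟩
    refine ⟨g1, fun x hx => by rw [g2, hreg' x hx], _, hf.merge hT hlt, g3,
      Or.inr (card_roots_mergeLabel hT)⟩
  · refine Wp.skip (by omega) ⟨hL', hreg', f, hf, hτ, Or.inl ⟨rfl, ?_⟩⟩
    intro i' j' hc' hlt hT
    obtain ⟨rfl, rfl⟩ := hij i' j' hc'
    exact htest.2 ⟨hlt, hT⟩ ht

/-- The state during the merging phase, with a labelling satisfying `P`. -/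
structure Merging (I : WSOCT) (P : (Fin I.n → Fin I.n) → Prop) (s : State) : Prop where
  loaded : I.Loaded s
  budget : s.reg 2 = I.denProd * I.k
  total : s.reg 3 = ∑ v, I.scaled v
  square : s.reg 4 = I.n * I.n
  table : ∃ f, IsLabelling I.G f ∧ IsTable I.G I.T I.scaled f s.cell ∧ P f

theorem Merging.imp {P Q : (Fin I.n → Fin I.n) → Prop} (h : I.Merging P s)
    (hPQ : ∀ f, P f → Q f) : I.Merging Q s := by
  obtain ⟨f, h1, h2, h3⟩ := h.table
  exact ⟨h.loaded, h.budget, h.total, h.square, f, h1, h2, hPQ f h3⟩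

theorem Merging.set {P : (Fin I.n → Fin I.n) → Prop} (h : I.Merging P s) {x : ℕ} (hx : 4 < x)
    (v : ℕ) : I.Merging P (s.set x v) := by
  obtain ⟨f, h1, h2, h3⟩ := h.table
  refine ⟨h.loaded.set (by omega) (by omega) v, ?_, ?_, ?_, f, h1, ?_, h3⟩
  · rw [State.set_reg, if_neg (by omega), h.budget]
  · rw [State.set_reg, if_neg (by omega), h.total]
  · rw [State.set_reg, if_neg (by omega), h.square]
  · rwa [show (s.set x v).cell = s.cell by ext a m; exact s.cell_set v a m (by omega)]

/-- After `r` rounds at least `r` merges have taken place, or only one class is left. -/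
def Progress (r : ℕ) (f : Fin I.n → Fin I.n) : Prop :=
  (roots f).card ≤ 1 ∨ (roots f).card + r ≤ I.n

/-- The loop invariant says that progress has been made or that some pair of twins, with number at
least `c`, is still ahead. A pair passed over leaves the labelling and these twins intact, any merge
yields progress, and at `c = n * n` no pair is ahead. -/
theorem wp_round (hG : NoInducedP4 I.G) {r : ℕ} (h5 : s.reg 5 = r)
    (h : I.Merging (Progress r) s) :
    Wp (.forLoop 6 4 pairProg) (I.n * I.n * (pairWeight I.n + 9) + 6)
      (fun s' => s'.reg 5 = r ∧ I.Merging (Progress (r + 1)) s') s := by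
  have hloop := Wp.forLoop (x := 6) (y := 4) (p := pairProg) (u := pairWeight I.n) (s := s)
    (fun c s' => s'.reg 5 = r ∧ I.Merging (fun f => Progress (r + 1) f ∨
      ((roots f).card + r ≤ I.n ∧
        ∃ i j : Fin I.n, i < j ∧ Twins I.G (roots f) i j ∧ c ≤ i * I.n + j)) s')
    (I.n * I.n) (by norm_num) h.square ?_ ?_
  · refine hloop.imp le_rfl ?_
    rintro s' ⟨h1, h2⟩
    refine ⟨h1, h2.imp ?_⟩
    rintro f (hf | ⟨-, i, j, -, -, hij⟩)
    · exact hf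
    · nlinarith [i.2, j.2]
  · refine ⟨by simp [h5], (h.imp fun f hf => ?_).set (by norm_num) _⟩
    rcases hf with hf | hf
    · exact Or.inl (Or.inl hf)
    by_cases h2 : 2 ≤ (roots f).card
    · obtain ⟨i, j, hT⟩ := hG.exists_twins h2
      rcases lt_or_gt_of_ne hT.2.2.1 with hlt | hlt
      · exact Or.inr ⟨hf, i, j, hlt, hT, Nat.zero_le _⟩
      · exact Or.inr ⟨hf, j, i, hlt, hT.symm, Nat.zero_le _⟩
    · exact Or.inl (Or.inl (by omega))
  · rintro c hc t ⟨ht5, ht⟩ ht6 ht4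
    obtain ⟨f, hf, hτ, hP⟩ := ht.table
    refine (wp_pairProg ht.loaded hf hτ hc ht6).imp le_rfl ?_
    rintro s' ⟨g1, g2, f', hf', hτ', hcase⟩
    have hM : I.Merging (fun f => Progress (r + 1) f ∨ ((roots f).card + r ≤ I.n ∧
        ∃ i j : Fin I.n, i < j ∧ Twins I.G (roots f) i j ∧ c + 1 ≤ i * I.n + j)) s' := by
      refine ⟨g1, ?_, ?_, ?_, f', hf', hτ', ?_⟩
      · rw [g2 2 (by norm_num), ht.budget]
      · rw [g2 3 (by norm_num), ht.total]
      · rw [g2 4 (by norm_num), ht.square]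
      · rcases hcase with ⟨rfl, hno⟩ | hcard
        · refine hP.imp_right ?_
          rintro ⟨h1, i, j, hlt, hT, hle⟩
          refine ⟨h1, i, j, hlt, hT, Nat.lt_of_le_of_ne hle fun h' => hno i j h'.symm hlt hT⟩
        · refine Or.inl ?_
          simp only [Progress] at *
          omega
    refine ⟨by rw [g2 6 (by norm_num), ht6], by rw [g2 4 (by norm_num), ht4], ?_,
      hM.set (by norm_num) _⟩
    simp [g2 5 (by norm_num), ht5]

/-- Multiplies register `2` by the denominator of the weight of the vertex in register `7`. -/
def denProg : Prog :=
  .assign 2 (.bin .mul (.reg 2) (.load (.add (.add (.add (.const 2) (.reg 1)) (.reg 1)) (.reg 7))))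

/-- The denominator is the right factor of the product, so a pass adds at most about `N` digits,
independently of the length of the accumulated product. -/
theorem wp_denProd (h : I.Loaded s) (h2 : s.reg 2 = 1) {N : ℕ}
    (hden : ∀ v, Nat.size (I.w v).den ≤ N) :
    Wp (.forLoop 7 1 denProg) (I.n * (20 + N + 9) + 6)
      (fun s' => I.Loaded s' ∧ s'.reg 2 = I.denProd) s := by
  have hloop := Wp.forLoop (x := 7) (y := 1) (p := denProg) (u := 20 + N) (s := s)
    (fun c s' => I.Loaded s' ∧
      s'.reg 2 = ∏ i ∈ Finset.range c, if hi : i < I.n then (I.w ⟨i, hi⟩).den else 1)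
    I.n (by norm_num) h.order ?_ ?_
  · refine hloop.imp le_rfl ?_
    rintro s' ⟨h1, h2⟩
    refine ⟨h1, ?_⟩
    rw [h2, Finset.prod_range, denProd]
    simp
  · exact ⟨h.set (by norm_num) (by norm_num) _, by simp [h2]⟩
  · rintro c hc t ⟨hL, ht2⟩ ht7 ht1
    have hd := hL.den ⟨c, hc⟩
    have hN := hden ⟨c, hc⟩
    refine Wp.assign ?_ ⟨by simp [ht7], by simp [ht1], (hL.set (by norm_num) (by norm_num) _).set
      (by norm_num) (by norm_num) _, ?_⟩
    · simp only [Expr.weight, Expr.weight_add, Expr.eval, Expr.eval_add, Op.extra, ht7, ht1, hd]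
      omega
    · simp only [State.set_reg, Expr.eval, Expr.eval_add, Op.eval, ht7, ht1, hd]
      simp [Finset.prod_range_succ, hc, ht2]

/-- Computes the scaled weight of the vertex in register `7`, adds it to register `3`, and fills in
the column of this vertex. -/
def columnProg : Prog :=
  .seq (.assign 8 (.bin .mul
    (.bin .div (.reg 2) (.load (.add (.add (.add (.const 2) (.reg 1)) (.reg 1)) (.reg 7))))
    (.load (.add (.add (.const 2) (.reg 1)) (.reg 7)))))
  (.seq (.assign 3 (.add (.reg 3) (.reg 8)))
  (.seq (.assign 9 (.bin .div (.reg 8) (.bin .sub (.const 1) (.load (.add (.const 2) (.reg 7))))))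
  (.seq (.store (.addr 0 (.reg 7)) (.const 1))
  (.seq (.store (.addr 1 (.reg 7)) (.reg 9))
  (.seq (.store (.addr 2 (.reg 7)) (.reg 8))
  (.seq (.store (.addr 3 (.reg 7)) (.reg 8))
  (.seq (.store (.addr 4 (.reg 7)) (.reg 8))
  (.store (.addr 5 (.reg 7)) (.reg 9)))))))))

/-- The columns of the table for the vertices below `c` are those of singleton classes. -/
def Columns (I : WSOCT) (c : ℕ) (s : State) : Prop :=
  ∀ v : Fin I.n, v.val < c → s.cell 0 v = 1 ∧ s.cell 1 v = (if v ∈ I.T then 0 else I.scaled v) ∧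
    s.cell 2 v = I.scaled v ∧ s.cell 3 v = I.scaled v ∧ s.cell 4 v = I.scaled v ∧
    s.cell 5 v = if v ∈ I.T then 0 else I.scaled v

theorem wp_columns (h : I.Loaded s) (h2 : s.reg 2 = I.denProd) (h3 : s.reg 3 = 0) {N : ℕ}
    (hnum : ∀ v, Nat.size (I.w v).num ≤ N) :
    Wp (.forLoop 7 1 columnProg) (I.n * (500 + N + 9) + 6)
      (fun s' => I.Loaded s' ∧ s'.reg 2 = I.denProd ∧ s'.reg 3 = ∑ v, I.scaled v ∧
        I.Columns I.n s') s := by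
  have hloop := Wp.forLoop (x := 7) (y := 1) (p := columnProg) (u := 500 + N) (s := s)
    (fun c s' => I.Loaded s' ∧ s'.reg 2 = I.denProd ∧
      s'.reg 3 = (∑ i ∈ Finset.range c, if hi : i < I.n then I.scaled ⟨i, hi⟩ else 0) ∧
      I.Columns c s')
    I.n (by norm_num) h.order ?_ ?_
  · refine hloop.imp le_rfl ?_
    rintro s' ⟨h1, h2, h3, h4⟩
    refine ⟨h1, h2, ?_, h4⟩
    rw [h3, Finset.sum_range]
    simp
  · exact ⟨h.set (by norm_num) (by norm_num) _, by simp [h2], by simp [h3],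
      fun v hv => absurd hv (Nat.not_lt_zero _)⟩
  · rintro c hc t ⟨hL, ht2, ht3, hcol⟩ ht7 ht1
    have hden := hL.den ⟨c, hc⟩
    have hnum' := hL.num ⟨c, hc⟩
    have hT := hL.mem_T ⟨c, hc⟩
    have hN := hnum ⟨c, hc⟩
    simp only at hden hnum' hT
    refine (Wp.seq (u := 40 + N) (v := 50 + (50 + (50 + (50 + (50 + (50 + (50 + 50)))))))
      (Wp.assign ?_ ?_)).imp (by omega) fun _ h => h
    · simp only [Expr.weight, Expr.weight_add, Expr.eval, Expr.eval_add, Op.extra, ht7, ht1, hnum']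
      omega
    have hval : Expr.eval t (.bin .mul (.bin .div (.reg 2) (.load (.add (.add (.add (.const 2)
        (.reg 1)) (.reg 1)) (.reg 7)))) (.load (.add (.add (.const 2) (.reg 1)) (.reg 7)))) =
        I.scaled ⟨c, hc⟩ := by
      simp only [Expr.eval, Expr.eval_add, Op.eval, ht7, ht1, ht2, hden, hnum', scaled]
    rw [hval]
    refine Wp.seq (Wp.assign (by simp [Expr.weight]) ?_)
    refine Wp.seq (Wp.assign (by simp [Expr.weight, Op.extra]) ?_)
    -- The divisor is 1 minus the indicator of `T`. For a vertex of `T` it is 0, and division by 0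
    -- returns the required entry 0.
    have hval' : Expr.eval ((t.set 8 (I.scaled ⟨c, hc⟩)).set 3 (Expr.eval (t.set 8
        (I.scaled ⟨c, hc⟩)) (.add (.reg 3) (.reg 8)))) (.bin .div (.reg 8)
        (.bin .sub (.const 1) (.load (.add (.const 2) (.reg 7))))) =
        if (⟨c, hc⟩ : Fin I.n) ∈ I.T then 0 else I.scaled ⟨c, hc⟩ := by
      simp only [Expr.eval, Expr.eval_add, Op.eval, State.set_reg, State.set_mem]
      norm_num only [if_true, if_false, ht7, hT]
      split_ifs <;> simp
    rw [hval']
    generalize ht' : (((t.set 8 (I.scaled ⟨c, hc⟩)).set 3 (Expr.eval (t.set 8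
        (I.scaled ⟨c, hc⟩)) (.add (.reg 3) (.reg 8)))).set 9
        (if (⟨c, hc⟩ : Fin I.n) ∈ I.T then 0 else I.scaled ⟨c, hc⟩)) = t'
    have hL' : I.Loaded t' := by
      rw [← ht']
      exact ((hL.set (by norm_num) (by norm_num) _).set (by norm_num) (by norm_num) _).set
        (by norm_num) (by norm_num) _
    have hcol' : I.Columns c t' := by
      intro v hv
      simp only [← ht', State.cell_set, ne_eq, OfNat.ofNat_ne_zero, not_false_eq_true]
      exact hcol v hv
    have q1 : t'.reg 1 = I.n := by simp [← ht', ht1]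
    have q2 : t'.reg 2 = I.denProd := by simp [← ht', ht2]
    have q3 : t'.reg 3 =
        ∑ i ∈ Finset.range (c + 1), if hi : i < I.n then I.scaled ⟨i, hi⟩ else 0 := by
      simp [← ht', ht3, Finset.sum_range_succ, hc, Expr.eval]
    have q7 : t'.reg 7 = c := by simp [← ht', ht7]
    have q8 : t'.reg 8 = I.scaled ⟨c, hc⟩ := by simp [← ht']
    have q9 : t'.reg 9 = if (⟨c, hc⟩ : Fin I.n) ∈ I.T then 0 else I.scaled ⟨c, hc⟩ := by
      simp [← ht']
    clear ht'
    refine Wp.seq (Wp.storeCell (by simp [Expr.weight]) ?_)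
    refine Wp.seq (Wp.storeCell (by simp [Expr.weight]) ?_)
    refine Wp.seq (Wp.storeCell (by simp [Expr.weight]) ?_)
    refine Wp.seq (Wp.storeCell (by simp [Expr.weight]) ?_)
    refine Wp.seq (Wp.storeCell (by simp [Expr.weight]) ?_)
    refine Wp.storeCell (by simp [Expr.weight]) ?_
    simp only [State.putCell_reg, Expr.eval, q7, q8, q9]
    refine ⟨trivial, q1, (hL'.putCell .. |>.putCell .. |>.putCell .. |>.putCell .. |>.putCell ..
      |>.putCell ..).set (by norm_num) (by norm_num) _, by simp [q2], by simp [q3], ?_⟩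
    intro v hv
    simp only [State.cell_set, ne_eq, OfNat.ofNat_ne_zero, not_false_eq_true]
    by_cases hvc : v.val = c
    · subst hvc
      simp [State.cell_putCell]
    · simpa [State.cell_putCell, hvc] using hcol' v (by omega)

/-- Decides Weighted Subset Odd Cycle Transversal on graphs without induced four-vertex paths. -/
def decisionProg : Prog :=
  .seq (.assign 1 (.load (.const 0)))
  (.seq (.assign 2 (.const 1))
  (.seq (.forLoop 7 1 denProg)
  (.seq (.assign 3 (.const 0))
  (.seq (.forLoop 7 1 columnProg)
  (.seq (.assign 2 (.bin .mul (.reg 2) (.load (.const 1))))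
  (.seq (.assign 4 (.bin .mul (.reg 1) (.reg 1)))
  (.seq (.forLoop 5 1 (.forLoop 6 4 pairProg))
  (.assign 0 (.lt (.reg 3) (.add (.add (.reg 2) (.load (.addr 4 (.const 0)))) (.const 1)))))))))))

/-- A bound for the weight of `decisionProg` on instances with `n` vertices and numbers with at most
`N` digits. -/
def decisionWeight (n N : ℕ) : ℕ :=
  10 + (10 + ((n * (20 + N + 9) + 6) + (10 + ((n * (500 + N + 9) + 6) + ((20 + N) + ((20 + n) +
    ((n * (n * n * (pairWeight n + 9) + 6 + 9) + 6) + 100)))))))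

/-- The final test `total < budget + best + 1` is the inequality of `isYes_iff`, with the optimum
read from row 4 and column 0. -/
theorem wp_decisionProg (hI : IsFree (SimpleGraph.pathGraph 4) I.G) {N : ℕ}
    (hnum : ∀ v, Nat.size (I.w v).num ≤ N) (hden : ∀ v, Nat.size (I.w v).den ≤ N)
    (hk : Nat.size I.k ≤ N) :
    Wp decisionProg (decisionWeight I.n N)
      (fun s => (I.IsYes → s.reg 0 = 1) ∧ (¬ I.IsYes → s.reg 0 = 0)) (init I.encode) := by
  have hmem0 : (init I.encode).mem 0 = I.n := by simp [init, encode]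
  have hsn := size_le_self I.n
  refine Wp.seq (Wp.assign (by simp [Expr.weight]) ?_)
  simp only [Expr.eval, hmem0]
  refine Wp.seq (Wp.assign (by simp [Expr.weight]) ?_)
  refine Wp.seq ((wp_denProd (I.loaded_init.set (by norm_num) (by norm_num) _)
    (by simp [Expr.eval]) hden).imp le_rfl ?_)
  rintro s₁ ⟨hL₁, h2₁⟩
  refine Wp.seq (Wp.assign (by simp [Expr.weight]) ?_)
  refine Wp.seq ((wp_columns (hL₁.set (by norm_num) (by norm_num) _) (by simp [h2₁])
    (by simp [Expr.eval]) hnum).imp le_rfl ?_)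
  rintro s₂ ⟨hL₂, h2₂, h3₂, hcol⟩
  refine Wp.seq (Wp.assign ?_ ?_)
  · simp only [Expr.weight, Expr.eval, Op.extra, hL₂.bound]
    omega
  refine Wp.seq (Wp.assign ?_ ?_)
  · simp only [Expr.weight, Expr.eval, Op.extra, State.set_reg]
    norm_num only [if_false, hL₂.order]
    omega
  simp only [Expr.eval, Op.eval, h2₂, hL₂.bound]
  have hM : I.Merging (Progress 0) ((s₂.set 2 (I.denProd * I.k)).set 4 (I.n * I.n)) := by
    refine ⟨(hL₂.set (by norm_num) (by norm_num) _).set (by norm_num) (by norm_num) _, by simp,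
      by simp [h3₂], by simp, id, isLabelling_id, ?_, Or.inr ?_⟩
    · have hcell : ((s₂.set 2 (I.denProd * I.k)).set 4 (I.n * I.n)).cell = s₂.cell := by
        ext a m
        simp only [State.cell_set, ne_eq, OfNat.ofNat_ne_zero, not_false_eq_true]
      rw [hcell]
      exact isTable_id (fun v => (hcol v v.2).1) (fun v => (hcol v v.2).2.1)
        (fun v => (hcol v v.2).2.2.1) (fun v => (hcol v v.2).2.2.2.1)
        (fun v => (hcol v v.2).2.2.2.2.1) (fun v => (hcol v v.2).2.2.2.2.2)
    · simpa using Finset.card_le_univ (roots (id : Fin I.n → Fin I.n))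
  have hsq : (s₂.set 2 (I.denProd * I.k)).reg 1 * (s₂.set 2 (I.denProd * I.k)).reg 1 =
      I.n * I.n := by simp [hL₂.order]
  rw [hsq]
  refine Wp.seq ((Wp.forLoop (fun r s' => I.Merging (Progress r) s') I.n (by norm_num)
    hM.loaded.order (hM.set (by norm_num) _) ?_).imp le_rfl ?_)
  · intro r hr t ht ht5 ht1
    refine (wp_round hI.noInducedP4 ht5 ht).imp le_rfl ?_
    rintro s' ⟨g1, g2⟩
    exact ⟨g1, g2.loaded.order, g2.set (by norm_num) _⟩
  · intro t ht
    refine Wp.assign (by simp [Expr.weight]) ?_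
    have hyes : I.IsYes ↔ t.reg 3 < t.reg 2 + t.cell 4 0 + 1 := by
      obtain ⟨f, hf, hτ, hP⟩ := ht.table
      rw [isYes_iff I hI, ht.budget, ht.total, Nat.lt_succ_iff]
      -- For `n = 0` the table has no columns and the cell read is meaningless, but the total weight
      -- is 0 and the test succeeds whatever it contains. For `n > 0`, `n` rounds leave at most one
      -- class.
      rcases Nat.eq_zero_or_pos I.n with h0 | h0
      · have : IsEmpty (Fin I.n) := by rw [h0]; infer_instance
        simp
      · rw [hτ.good_zero hf (by simp only [Progress] at hP; omega) h0]
    have heval : (Expr.lt (.reg 3) (.add (.add (.reg 2) (.load (.addr 4 (.const 0))))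
        (.const 1))).eval t = if t.reg 3 < t.reg 2 + t.cell 4 0 + 1 then 1 else 0 := rfl
    rw [heval]
    refine ⟨fun h => ?_, fun h => ?_⟩
    · simp [hyes.1 h]
    · simp [mt hyes.2 h]

theorem decisionWeight_mono {n n' N N' : ℕ} (hn : n ≤ n') (hN : N ≤ N') :
    decisionWeight n N ≤ decisionWeight n' N' := by
  unfold decisionWeight pairWeight
  gcongr

open Polynomial in
theorem exists_polynomial_decisionWeight :
    ∃ p : Polynomial ℕ, ∀ N, p.eval N = decisionWeight N N := by
  refine ⟨10 + (10 + ((X * (20 + X + 9) + 6) + (10 + ((X * (500 + X + 9) + 6) + ((20 + X) +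
    ((20 + X) + ((X * (X * X * ((20 + ((20 + X) + (20 + ((X * (150 + 2 * X + 9) + 6) +
    (100 + (4000 + X)))))) + 9) + 6 + 9) + 6) + 100))))))), fun N => ?_⟩
  simp only [eval_add, eval_mul, eval_X, eval_ofNat, decisionWeight, pairWeight]

end WSOCT

theorem mainTheorem9 :
    RAM.PolyTimeSolvableOn WSOCT.encode WSOCT.IsYes
      (fun I : WSOCT => IsFree (SimpleGraph.pathGraph 4) I.G) := by
  obtain ⟨p, hp⟩ := WSOCT.exists_polynomial_decisionWeight
  -- The bound `u * (B + u + 1)` of `Wp.exec`, where `B` is the input size and `p` bounds the weight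
  -- `u`; the input size bounds both the number of vertices and the lengths of all numbers.
  refine ⟨WSOCT.decisionProg, p * (Polynomial.X + p + 1), fun I hI => ?_⟩
  have hmem : ∀ x ∈ I.encode, Nat.size x ≤ RAM.inputSize I.encode :=
    fun x hx => RAM.size_le_inputSize hx
  have hn : I.n ≤ RAM.inputSize I.encode := by
    have := RAM.length_le_inputSize I.encode
    rw [WSOCT.length_encode] at this
    nlinarith [Nat.zero_le (I.n * I.n)]
  obtain ⟨s, t, h1, h2, h3, h4⟩ := (WSOCT.wp_decisionProg (N := RAM.inputSize I.encode) hI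
    (fun v => hmem _ (by simp [WSOCT.encode, List.mem_ofFn]))
    (fun v => hmem _ (by simp [WSOCT.encode, List.mem_ofFn]))
    (hmem _ (by simp [WSOCT.encode]))).exec
  refine ⟨s, t, h1, h2.trans ?_, h3, h4⟩
  have := WSOCT.decisionWeight_mono hn (le_refl (RAM.inputSize I.encode))
  simp only [Polynomial.eval_mul, Polynomial.eval_add, Polynomial.eval_X, Polynomial.eval_one, hp]
  gcongr
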